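/- Let $d\ge 1$, $r\ge 0$ be integers, let $\Lambda>0$, and let $\mathbb T^d:=(\mathbb R/2\pi\mathbb Z)^d$. Let $\{a_n:n\in\mathbb Z^d\setminus\{0\}\}$ be complex-valued random variables whose real and imaginary parts are centered normal variables with variance $1/2$ and which are independent but for the constraint $a_{-n}=\overline{a_n}$ (that is, the variables $\operatorname{Re}a_n,\operatorname{Im}a_n$, $n\in S$, are independent for each set $S$ of frequencies with $S\cap(-S)=\emptyset$). For each integer $L\ge 1$ set $$V^L(q):=\frac1{\sqrt{d_L}}\sum_{0<|n|_\infty\le L}a_n\,e^{in\cdot q},\qquad q\in\mathbb T^d,\qquad |n|_\infty:=\max_{1\le j\le d}|n_j|,\qquad d_L:=\#\{n\in\mathbb Z^d:0<|n|_\infty\le L\},$$ and, for $q\in\mathbb T^d$ and $x\in\mathbb R^d$, set $V^{L,q}(x):=V^L(q+\Lambda x/L)$. Let $\{b_n:n\in\mathbb Z^d\}$ be independent real-valued standard normal variables, and set $$W(x):=\lim_{N\to\infty}\ \sum_{n\in\mathbb Z^d,\ |n|_\infty\le N} b_n\,\widehat\phi_n(x),\qquad \widehat\phi_n(x):=(2\Lambda)^{-d}\int_{[-\Lambda,\Lambda]^d}e^{ix\cdot\xi}\,e^{i\pi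 n\cdot\xi/\Lambda}\,d\xi .$$ For $R>0$, let $C^r(B_R)$ be the space of real-valued functions that are of class $C^r$ up to the boundary on the ball of radius $R$ centered at the origin of $\mathbb R^d$, with the $C^r$ norm (the maximum of the suprema over the ball of the derivatives of orders $0,\dots,r$) and its Borel $\sigma$-algebra. Then the functions $V^{L,q}$ are of class $C^r$ on $\mathbb R^d$; almost surely, the limit defining $W(x)$ exists for all $x\in\mathbb R^d$ and $W$ is of class $C^r$ on $\mathbb R^d$; and, fixing any $R>0$ and denoting by $\mu^{L,q}_R$ and $\mu_{W,R}$ the probability measures on $C^r(B_R)$ defined by the restrictions to the ball of the Gaussian random fields $V^{L,q}$ and $W$, respectively, one has for every $q\in\mathbb T^d$ that $\mu^{L,q}_R$ converges weakly to $\mu_{W,R}$ as $L\to\infty$. -/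

import Mathlib

open MeasureTheory ProbabilityTheory Filter Topology

noncomputable section

namespace RandomPotential

/-! ### The space `C^r(B_R)` -/

/-- Euclidean space `ℝ^d`. -/
abbrev Space (d : ℕ) : Type := EuclideanSpace ℝ (Fin d)

/-- The closed ball of radius `R` centered at the origin of `ℝ^d`. -/
abbrev ball (d : ℕ) (R : ℝ) : Set (Space d) := Metric.closedBall 0 R

/-- The space `C^r(B_R)` of real functions that are of class `C^r` up to the boundary on the ball
`B_R`. (The extension by zero only serves to feed a function defined on the ball to
`ContDiffOn`, which does not look at values outside the ball.) -/
structure CrBall (d r : ℕ) (R : ℝ) where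
  toFun : ball d R → ℝ
  contDiffOn : ContDiffOn ℝ r (Function.extend Subtype.val toFun 0) (ball d R)

namespace CrBall

variable {d r : ℕ} {R : ℝ}

/-- The `k`-th derivative of `f ∈ C^r(B_R)`, as a function on the ball. -/
def derivative (f : CrBall d r R) (k : ℕ) (x : ball d R) :
    ContinuousMultilinearMap ℝ (fun _ : Fin k => Space d) ℝ :=
  iteratedFDerivWithin ℝ k (Function.extend Subtype.val f.toFun 0) (ball d R) x

theorem continuous_derivative (f : CrBall d r R) (k : Fin (r + 1)) :
    Continuous (f.derivative k) := by
  rcases lt_or_ge 0 R with hR | hR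
  · have hu : UniqueDiffOn ℝ (ball d R) :=
      uniqueDiffOn_convex (convex_closedBall _ _)
        ⟨0, Metric.ball_subset_interior_closedBall (Metric.mem_ball_self hR)⟩
    have hk : ((k : ℕ) : WithTop ℕ∞) ≤ (r : WithTop ℕ∞) := by
      exact_mod_cast Nat.lt_succ_iff.mp k.2
    exact continuousOn_iff_continuous_domRestrict.mp
      (f.contDiffOn.continuousOn_iteratedFDerivWithin hk hu)
  · have : Subsingleton (ball d R) := by
      refine ⟨fun x y => Subtype.ext ?_⟩
      have hx : ‖(x : Space d)‖ ≤ 0 := (mem_closedBall_zero_iff.mp x.2).trans hR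
      have hy : ‖(y : Space d)‖ ≤ 0 := (mem_closedBall_zero_iff.mp y.2).trans hR
      rw [norm_le_zero_iff.mp hx, norm_le_zero_iff.mp hy]
    exact continuous_of_const fun x y => by rw [Subsingleton.elim x y]

/-- All the derivatives of orders `0, …, r` of a function in `C^r(B_R)`. -/
def jet (f : CrBall d r R) (k : Fin (r + 1)) :
    C(ball d R, ContinuousMultilinearMap ℝ (fun _ : Fin (k : ℕ) => Space d) ℝ) :=
  ⟨f.derivative k, f.continuous_derivative k⟩

theorem jet_injective : Function.Injective (jet : CrBall d r R → _) := by
  rintro ⟨f, hf⟩ ⟨g, hg⟩ h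
  have key : f = g := by
    funext x
    have h0 : derivative ⟨f, hf⟩ 0 x = derivative ⟨g, hg⟩ 0 x := DFunLike.congr_fun (congrFun h 0) x
    have h1 := congrArg (fun m => m (fun _ => 0)) h0
    have e : ∀ (u : ball d R → ℝ), Function.extend Subtype.val u 0 (x : Space d) = u x :=
      fun u => Subtype.val_injective.extend_apply u 0 x
    simpa [derivative, iteratedFDerivWithin_zero_apply, e] using h1
  subst key
  rfl

/-- The metric of the `C^r` norm: the distance between `f` and `g` is
`max_{k ≤ r} sup_{x ∈ B_R} ‖D^k f(x) - D^k g(x)‖`. -/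
instance : MetricSpace (CrBall d r R) := MetricSpace.induced jet jet_injective inferInstance

instance : MeasurableSpace (CrBall d r R) := borel _

instance : BorelSpace (CrBall d r R) := ⟨rfl⟩

theorem contDiffOn_zero :
    ContDiffOn ℝ r (Function.extend Subtype.val (fun _ : ball d R => (0 : ℝ)) 0) (ball d R) := by
  refine (contDiffOn_const (c := (0 : ℝ))).congr fun x hx => ?_
  exact Subtype.val_injective.extend_apply (fun _ : ball d R => (0 : ℝ)) 0 ⟨x, hx⟩

theorem contDiffOn_restrict {g : Space d → ℝ} (hg : ContDiffOn ℝ r g (ball d R)) :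
    ContDiffOn ℝ r (Function.extend Subtype.val ((ball d R).domRestrict g) 0) (ball d R) :=
  hg.congr fun x hx => Subtype.val_injective.extend_apply ((ball d R).domRestrict g) 0 ⟨x, hx⟩

open Classical in
/-- The restriction of `g : ℝ^d → ℝ` to the ball, as an element of `C^r(B_R)`. It takes the
default value `0` if `g` is not of class `C^r` on the ball. -/
def ofFun (r : ℕ) (R : ℝ) (g : Space d → ℝ) : CrBall d r R :=
  if hg : ContDiffOn ℝ r g (ball d R) then ⟨(ball d R).domRestrict g, contDiffOn_restrict hg⟩
  else ⟨fun _ => 0, contDiffOn_zero⟩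

end CrBall

/-! ### The random trigonometric potentials on the torus -/

/-- The torus `(ℝ/2πℤ)^d`. -/
abbrev Torus (d : ℕ) : Type := Fin d → AddCircle (2 * Real.pi)

/-- The character `e^{i n·q}` of the torus. -/
def character {d : ℕ} (n : Fin d → ℤ) (q : Torus d) : ℂ := ∏ j, fourier (n j) (q j)

/-- The frequencies `n ∈ ℤ^d` with `0 < max_j |n_j| ≤ L`. -/
def frequencies (d L : ℕ) : Finset (Fin d → ℤ) :=
  (Finset.Icc (fun _ => -(L : ℤ)) (fun _ => (L : ℤ))).erase 0

theorem mem_frequencies {d L : ℕ} (n : Fin d → ℤ) :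
    n ∈ frequencies d L ↔ n ≠ 0 ∧ ∀ j, |n j| ≤ L := by
  simp [frequencies, Pi.le_def, abs_le, forall_and]

/-- The random variables `a n`, `n ∈ ℤ^d \ {0}`, are complex valued, their real and imaginary
parts are centered normal with variance `1/2`, and they are independent but for the constraint
`a (-n) = conj (a n)`: all the real and imaginary parts are independent as long as one only takes
at most one of any two opposite frequencies. (The value `a 0` plays no role.) -/
structure IsTrigCoefficients {d : ℕ} {Ω : Type*} [MeasurableSpace Ω] (P : Measure Ω)
    (a : (Fin d → ℤ) → Ω → ℂ) : Prop where
  conj : ∀ n, n ≠ 0 → ∀ᵐ ω ∂P, a (-n) ω = (starRingEnd ℂ) (a n ω)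
  law_re : ∀ n, n ≠ 0 → HasLaw (fun ω => (a n ω).re) (gaussianReal 0 (1 / 2)) P
  law_im : ∀ n, n ≠ 0 → HasLaw (fun ω => (a n ω).im) (gaussianReal 0 (1 / 2)) P
  indep : ∀ S : Set (Fin d → ℤ), (∀ n ∈ S, -n ∉ S) →
    iIndepFun (Sum.elim (fun (n : S) ω => (a n ω).re) (fun (n : S) ω => (a n ω).im)) P

/-- The random trigonometric potential as a complex number,
`d_L^{-1/2} ∑_{0 < |n|_∞ ≤ L} a_n e^{i n·q}`, for given values of the coefficients `a_n`. Here
`d_L` is the number of frequencies. -/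
def trigSum {d : ℕ} (L : ℕ) (a : (Fin d → ℤ) → ℂ) (q : Torus d) : ℂ :=
  ((1 / Real.sqrt ((frequencies d L).card : ℝ) : ℝ) : ℂ) *
    ∑ n ∈ frequencies d L, a n * character n q

/-- The trigonometric potential `V^L(q)`. Under the constraint `a_{-n} = conj a_n`, `trigSum` is
real, so that passing to the real part only changes the type. -/
def trigPotential {d : ℕ} (L : ℕ) (a : (Fin d → ℤ) → ℂ) (q : Torus d) : ℝ := (trigSum L a q).re

theorem ofReal_trigPotential {d : ℕ} (L : ℕ) (a : (Fin d → ℤ) → ℂ) (q : Torus d)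
    (ha : ∀ n, n ≠ 0 → a (-n) = (starRingEnd ℂ) (a n)) :
    (trigPotential L a q : ℂ) = trigSum L a q := by
  apply Complex.conj_eq_iff_re.mp
  have hc : ∀ n : Fin d → ℤ, character (-n) q = (starRingEnd ℂ) (character n q) := by
    intro n
    simp only [character, map_prod, Pi.neg_apply]
    exact Finset.prod_congr rfl fun j _ => fourier_neg
  simp only [trigSum, map_mul, Complex.conj_ofReal, map_sum]
  congr 1
  refine Finset.sum_bij' (fun n _ => -n) (fun n _ => -n) ?_ ?_ ?_ ?_ ?_
  · intro n hn
    simpa [mem_frequencies] using hn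
  · intro n hn
    simpa [mem_frequencies] using hn
  · intro n _
    exact neg_neg n
  · intro n _
    exact neg_neg n
  · intro n hn
    rw [hc, ha n ((mem_frequencies n).mp hn).1]

/-- The rescaled potential `V^{L,q}(x) = V^L(q + Λ x / L)`, `x ∈ ℝ^d`. -/
def rescaledPotential {d : ℕ} (Λ : ℝ) (L : ℕ) (a : (Fin d → ℤ) → ℂ) (q : Torus d)
    (x : Space d) : ℝ :=
  trigPotential L a (fun j => q j + ((Λ * x j / L : ℝ) : AddCircle (2 * Real.pi)))

/-! ### The random potential on `ℝ^d` -/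

/-- The cube `[-Λ, Λ]^d`. -/
def cube (d : ℕ) (Λ : ℝ) : Set (Fin d → ℝ) := Set.Icc (fun _ => -Λ) (fun _ => Λ)

/-- `φ_n(ξ) = e^{iπ n·ξ/Λ} 1_{[-Λ,Λ]^d}(ξ)`. -/
def phi {d : ℕ} (Λ : ℝ) (n : Fin d → ℤ) : (Fin d → ℝ) → ℂ :=
  (cube d Λ).indicator fun ξ =>
    Complex.exp (Complex.I * ((Real.pi * (∑ j, (n j : ℝ) * ξ j) / Λ : ℝ) : ℂ))

/-- `(2Λ)^{-d} ∫_{[-Λ,Λ]^d} e^{i x·ξ} φ_n(ξ) dξ`, as a complex number. -/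
def phiHatComplex {d : ℕ} (Λ : ℝ) (n : Fin d → ℤ) (x : Space d) : ℂ :=
  (((2 * Λ) ^ d)⁻¹ : ℝ) *
    ∫ ξ in cube d Λ, Complex.exp (Complex.I * ((∑ j, x j * ξ j : ℝ) : ℂ)) * phi Λ n ξ

/-- The (normalized) Fourier transform of `φ_n`, which is real valued. -/
def phiHat {d : ℕ} (Λ : ℝ) (n : Fin d → ℤ) (x : Space d) : ℝ := (phiHatComplex Λ n x).re

theorem ofReal_phiHat {d : ℕ} (Λ : ℝ) (n : Fin d → ℤ) (x : Space d) :
    (phiHat Λ n x : ℂ) = phiHatComplex Λ n x := by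
  apply Complex.conj_eq_iff_re.mp
  have hm : ∀ ξ : Fin d → ℝ, -ξ ∈ cube d Λ ↔ ξ ∈ cube d Λ := by
    intro ξ
    simp only [cube, Set.mem_Icc, Pi.le_def, Pi.neg_apply]
    constructor <;> rintro ⟨h1, h2⟩ <;>
      exact ⟨fun j => by linarith [h2 j], fun j => by linarith [h1 j]⟩
  have hs : MeasurableSet (cube d Λ) := measurableSet_Icc
  simp only [phiHatComplex, map_mul, Complex.conj_ofReal]
  congr 1
  rw [← integral_conj, ← integral_indicator hs, ← integral_indicator hs,
    ← integral_neg_eq_self]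
  refine integral_congr_ae (Eventually.of_forall fun ξ => ?_)
  by_cases h : ξ ∈ cube d Λ
  · have h' := (hm ξ).mpr h
    simp [phi, h, h', ← Complex.exp_conj, Finset.sum_neg_distrib, neg_div]
  · have h' : -ξ ∉ cube d Λ := fun h'' => h ((hm ξ).mp h'')
    beta_reduce
    rw [Set.indicator_of_notMem h', Set.indicator_of_notMem h]

/-- The partial sum `∑_{|n_1|, …, |n_d| ≤ N} b_n φ̂_n(x)`, for given values of the coefficients. -/
def partialSum {d : ℕ} (Λ : ℝ) (b : (Fin d → ℤ) → ℝ) (N : ℕ) (x : Space d) : ℝ :=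
  ∑ n ∈ Finset.Icc (fun _ => -(N : ℤ)) (fun _ => (N : ℤ)), b n * phiHat Λ n x

/-- `W(x) = ∑_{n ∈ ℤ^d} b_n φ̂_n(x)`, the limit of the partial sums over growing cubes. -/
def limitPotential {d : ℕ} (Λ : ℝ) (b : (Fin d → ℤ) → ℝ) (x : Space d) : ℝ :=
  limUnder atTop fun N => partialSum Λ b N x

end RandomPotential

end

noncomputable section

/-! Both fields are random power series with jointly Gaussian coefficients. Expanding `e^{i x·ξ}`
over words `w` gives monomials in `x` with coefficients `symbol w ξ`, so that `V^{L,q}` and (almost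
surely) `W` take the form `field z`, each `z w` being real-linear in the Gaussian data.

A finite linear combination of the coefficients of `V^{L,q}` is the coefficient of a single symbol
`g` with `g (-ξ) = conj (g ξ)`. It is centered normal, and its variance is the mean of `‖g‖²` over
the points `Λ n / L` (`hasLaw_trigCoef`); the phase `e^{i n·q}` drops out. These means are Riemann
sums for the mean of `‖g‖²` over the cube (`tendsto_mean_frequencies`), which by Parseval
(`hasSum_sq_cubeCoef`) is the variance of the same combination for `W` (`integral_cexp_limitCoef`).
Hence every finite block of coefficients converges in distribution (`tendstoInDistribution_coef`).

No separate tightness argument is needed. The `C^r` distance is bounded by an `ℓ¹` norm of the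
coefficients with weights geometric in the length of the word (`exists_dist_field_le`), while a
coefficient of length `k` has mean absolute value at most `Λ^k / k!`, whatever `L` is
(`lintegral_enorm_trigCoef_symbol_le`). Dropping the long words therefore costs little uniformly in
`L`, and `tendstoInDistribution_of_approx` concludes.

For the existence of `W`, the partial sums of each coefficient are an `L¹`-bounded martingale, hence
converge. Doob's maximal inequality and Borel–Cantelli dominate all partial sums by one rapidly
decaying sequence, so the limit passes through the power series (`ae_limitCoef_of_measurable`). -/

namespace RandomPotential

open scoped ENNReal NNReal

/-! ### Gaussian variables: linear combinations, characteristic function, first moment. -/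

section Gaussian

variable {Ω ι : Type*} [MeasurableSpace Ω] {P : Measure Ω}

/-- A linear combination of independent centered Gaussian variables of the same variance is
Gaussian. -/
theorem hasLaw_sum_gaussianReal [IsProbabilityMeasure P] {X : ι → Ω → ℝ} {v : ℝ≥0}
    (hX : ∀ i, HasLaw (X i) (gaussianReal 0 v) P) (hind : iIndepFun X P) (s : Finset ι)
    (c : ι → ℝ) :
    HasLaw (fun ω => ∑ i ∈ s, c i * X i ω)
      (gaussianReal 0 (Real.toNNReal ((∑ i ∈ s, c i ^ 2) * v))) P := by
  classical
  have hind' : iIndepFun (fun i ω => c i * X i ω) P :=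
    hind.comp (fun i x => c i * x) fun i => measurable_const_mul (c i)
  have hlaw : ∀ i, HasLaw (fun ω => c i * X i ω)
      (gaussianReal 0 (Real.toNNReal (c i ^ 2 * v))) P := by
    intro i
    have h := gaussianReal_const_mul (hX i) (c i)
    rw [mul_zero] at h
    convert h using 2
    ext
    simp [Real.toNNReal_of_nonneg, mul_nonneg, sq_nonneg]
  have hae : ∀ i, AEMeasurable (fun ω => c i * X i ω) P := fun i => (hlaw i).aemeasurable
  induction s using Finset.induction_on with
  | empty =>
    refine ⟨by fun_prop, ?_⟩
    simp [Measure.map_const]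
  | insert j s hj ih =>
    refine ⟨by fun_prop, ?_⟩
    have hI := (hind'.indepFun_finsetSum_of_notMem₀ hae hj).symm
    have hs : (∑ i ∈ s, fun ω => c i * X i ω) = fun ω => ∑ i ∈ s, c i * X i ω := by
      ext ω; simp
    rw [hs] at hI
    have h := gaussianReal_add_gaussianReal_of_indepFun hI (hlaw j).map_eq ih.map_eq
    have e : (fun ω => ∑ i ∈ insert j s, c i * X i ω) =
        (fun ω => c j * X j ω) + fun ω => ∑ i ∈ s, c i * X i ω := by
      ext ω; simp [Finset.sum_insert hj]
    rw [e, h, Finset.sum_insert hj, add_mul, Real.toNNReal_add (by positivity), add_zero]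
    exact mul_nonneg (Finset.sum_nonneg fun i _ => sq_nonneg _) v.2

theorem integral_cexp_of_hasLaw {X : Ω → ℝ} {v : ℝ} (hv : 0 ≤ v)
    (hX : HasLaw X (gaussianReal 0 (Real.toNNReal v)) P) :
    ∫ ω, Complex.exp ((X ω : ℂ) * Complex.I) ∂P = Complex.exp (-(v : ℂ) / 2) := by
  have h := charFun_gaussianReal (μ := 0) (v := Real.toNNReal v) 1
  rw [charFun_apply] at h
  have h2 := hX.integral_comp
    (f := fun x : ℝ => Complex.exp ((inner ℝ x (1 : ℝ) : ℂ) * Complex.I)) (by fun_prop)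
  rw [h] at h2
  simp only [Function.comp_def] at h2
  convert h2 using 2
  · simp
  · simp [Real.coe_toNNReal v hv]
    ring

theorem lintegral_enorm_le_of_hasLaw [IsProbabilityMeasure P] {X : Ω → ℝ} {s : ℝ} (hs : 0 ≤ s)
    (hX : HasLaw X (gaussianReal 0 (Real.toNNReal (s ^ 2))) P) :
    ∫⁻ ω, ‖X ω‖ₑ ∂P ≤ ENNReal.ofReal s := by
  have hm : MemLp X 2 P := by
    have := memLp_id_gaussianReal' (μ := 0) (v := Real.toNNReal (s ^ 2)) 2 (by simp)
    rw [← hX.map_eq] at this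
    exact (memLp_map_measure_iff (by fun_prop) hX.aemeasurable).1 this
  have h1 : eLpNorm X 1 P ≤ eLpNorm X 2 P :=
    eLpNorm_le_eLpNorm_of_exponent_le (by norm_num) hm.1
  rw [eLpNorm_one_eq_lintegral_enorm] at h1
  refine h1.trans ?_
  have h2 : ∫ ω, X ω ^ 2 ∂P = s ^ 2 := by
    have := hX.integral_comp (f := fun x => x ^ 2) (by fun_prop)
    rw [Function.comp_def] at this
    rw [this]
    have hv := variance_fun_id_gaussianReal (μ := 0) (v := Real.toNNReal (s ^ 2))
    rw [variance_eq_integral (by fun_prop)] at hv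
    simpa [sq_nonneg] using hv
  rw [MemLp.eLpNorm_eq_integral_rpow_norm (by norm_num) (by norm_num) hm]
  refine ENNReal.ofReal_le_ofReal ?_
  simp only [ENNReal.toReal_ofNat, Real.rpow_two, Real.norm_eq_abs, sq_abs, h2]
  rw [← one_div, ← Real.sqrt_eq_rpow, Real.sqrt_sq hs]

end Gaussian

/-! ### Gaussian series as martingales. -/

section Martingale

variable {Ω ι : Type*}

/-- The filtration generated by the variables whose index is in the growing sets `C N`. -/
def setFiltration [mΩ : MeasurableSpace Ω] {ξ : ι → Ω → ℝ} (hm : ∀ i, Measurable (ξ i)) {C : ℕ → Finset ι}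
    (hC : Monotone C) : Filtration ℕ mΩ where
  seq N := ⨆ i ∈ (C N : Set ι), MeasurableSpace.comap (ξ i) inferInstance
  mono' _ _ h := biSup_mono fun _ hi => hC h hi
  le' _ := iSup₂_le fun i _ => (hm i).comap_le

theorem measurable_sum_iSup_comap {ξ : ι → Ω → ℝ} (s : Finset ι) (S : Set ι) (hs : ↑s ⊆ S)
    (γ : ι → ℝ) :
    Measurable[⨆ i ∈ S, MeasurableSpace.comap (ξ i) inferInstance]
      (fun ω => ∑ i ∈ s, γ i * ξ i ω) := by
  refine Finset.measurable_sum _ fun i hi => Measurable.const_mul ?_ _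
  have h1 : Measurable[MeasurableSpace.comap (ξ i) inferInstance] (ξ i) :=
    comap_measurable _
  exact h1.mono (le_iSup₂_of_le (f := fun i (_ : i ∈ S) =>
    MeasurableSpace.comap (ξ i) inferInstance) i (hs hi) le_rfl) le_rfl

variable [MeasurableSpace Ω] {P : Measure Ω} [IsProbabilityMeasure P]

/-- The increment only involves indices in `C (N + 1) \ C N`, so it is centered and independent of
the past. -/
theorem martingale_sum_of_iIndepFun {ξ : ι → Ω → ℝ} (hm : ∀ i, Measurable (ξ i))
    (hint : ∀ i, Integrable (ξ i) P) (hzero : ∀ i, ∫ ω, ξ i ω ∂P = 0)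
    (hind : iIndepFun ξ P) {C : ℕ → Finset ι} (hC : Monotone C) (γ : ι → ℝ) :
    Martingale (fun N ω => ∑ i ∈ C N, γ i * ξ i ω) (setFiltration hm hC) P := by
  classical
  have hInt : ∀ s : Finset ι, Integrable (fun ω => ∑ i ∈ s, γ i * ξ i ω) P := fun s =>
    integrable_finsetSum _ fun i _ => (hint i).const_mul _
  have hadapt : StronglyAdapted (setFiltration hm hC) (fun N ω => ∑ i ∈ C N, γ i * ξ i ω) :=
    fun N => (measurable_sum_iSup_comap (C N) _ subset_rfl γ).stronglyMeasurable
  refine martingale_nat hadapt (fun N => hInt _) fun N => ?_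
  have hsplit : (fun ω => ∑ i ∈ C (N + 1), γ i * ξ i ω) =
      (fun ω => ∑ i ∈ C N, γ i * ξ i ω) + fun ω => ∑ i ∈ C (N + 1) \ C N, γ i * ξ i ω := by
    ext ω
    simp only [Pi.add_apply]
    rw [← Finset.sum_sdiff (hC N.le_succ)]
    exact add_comm _ _
  have hI : Indep (⨆ i ∈ ((C (N + 1) \ C N : Finset ι) : Set ι),
      MeasurableSpace.comap (ξ i) inferInstance) (setFiltration hm hC N) P := by
    refine indep_iSup_of_disjoint (fun i => (hm i).comap_le) hind ?_
    rw [Finset.disjoint_coe]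
    exact Finset.sdiff_disjoint
  have hE := condExp_indep_eq (iSup₂_le fun i _ => (hm i).comap_le) ((setFiltration hm hC).le N)
    (measurable_sum_iSup_comap (C (N + 1) \ C N) _ subset_rfl γ).stronglyMeasurable hI
  have h0 : ∫ ω, ∑ i ∈ C (N + 1) \ C N, γ i * ξ i ω ∂P = 0 := by
    rw [integral_finsetSum _ fun i _ => (hint i).const_mul _]
    exact Finset.sum_eq_zero fun i _ => by rw [integral_const_mul, hzero, mul_zero]
  rw [h0] at hE
  have hadd := condExp_add (hInt (C N)) (hInt (C (N + 1) \ C N)) (setFiltration hm hC N)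
  have hself := condExp_of_stronglyMeasurable ((setFiltration hm hC).le N) (hadapt N) (hInt _)
  rw [hsplit]
  filter_upwards [hadd, hE] with ω h1 h2
  rw [h1, Pi.add_apply, h2, hself, add_zero]

theorem martingale_sum_gaussian {ξ : ι → Ω → ℝ} (hm : ∀ i, Measurable (ξ i))
    (hlaw : ∀ i, HasLaw (ξ i) (gaussianReal 0 1) P) (hind : iIndepFun ξ P)
    {C : ℕ → Finset ι} (hC : Monotone C) (γ : ι → ℝ) :
    Martingale (fun N ω => ∑ i ∈ C N, γ i * ξ i ω) (setFiltration hm hC) P := by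
  refine martingale_sum_of_iIndepFun hm (fun i => ?_) (fun i => ?_) hind hC γ
  · have := memLp_id_gaussianReal' (μ := 0) (v := 1) 1 (by simp)
    rw [← (hlaw i).map_eq] at this
    exact memLp_one_iff_integrable.1
      ((memLp_map_measure_iff (by fun_prop) (hlaw i).aemeasurable).1 this)
  · have := (hlaw i).integral_comp (f := fun x => x) (by fun_prop)
    simpa [Function.comp_def] using this

theorem lintegral_enorm_sum_gaussian_le {ξ : ι → Ω → ℝ}
    (hlaw : ∀ i, HasLaw (ξ i) (gaussianReal 0 1) P) (hind : iIndepFun ξ P) (s : Finset ι)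
    {γ : ι → ℝ} {σ : ℝ} (hσ : 0 ≤ σ) (hγ : ∑ i ∈ s, γ i ^ 2 ≤ σ ^ 2) :
    ∫⁻ ω, ‖∑ i ∈ s, γ i * ξ i ω‖ₑ ∂P ≤ ENNReal.ofReal σ := by
  have h := hasLaw_sum_gaussianReal hlaw hind s γ
  rw [NNReal.coe_one, mul_one,
    ← Real.sq_sqrt (Finset.sum_nonneg fun i (_ : i ∈ s) => sq_nonneg (γ i))] at h
  exact (lintegral_enorm_le_of_hasLaw (Real.sqrt_nonneg _) h).trans
    (ENNReal.ofReal_le_ofReal (Real.sqrt_le_iff.2 ⟨hσ, hγ⟩))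

theorem ae_exists_tendsto_sum_gaussian {ξ : ι → Ω → ℝ} (hm : ∀ i, Measurable (ξ i))
    (hlaw : ∀ i, HasLaw (ξ i) (gaussianReal 0 1) P) (hind : iIndepFun ξ P)
    {C : ℕ → Finset ι} (hC : Monotone C) {γ : ι → ℝ} {σ : ℝ} (hσ : 0 ≤ σ)
    (hγ : ∀ N, ∑ i ∈ C N, γ i ^ 2 ≤ σ ^ 2) :
    ∀ᵐ ω ∂P, ∃ c, Tendsto (fun N => ∑ i ∈ C N, γ i * ξ i ω) atTop (𝓝 c) := by
  refine (martingale_sum_gaussian hm hlaw hind hC γ).submartingale.exists_ae_tendsto_of_bdd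
    (R := σ.toNNReal) fun N => ?_
  rw [eLpNorm_one_eq_lintegral_enorm]
  exact lintegral_enorm_sum_gaussian_le hlaw hind _ hσ (hγ N)

/-- Doob's maximal inequality for the submartingale `|M N|`, whose mean is at most `σ`. The first
power of `σ / t` suffices because `σ` will decay factorially. -/
theorem measure_exists_le_abs_sum_gaussian_le {ξ : ι → Ω → ℝ} (hm : ∀ i, Measurable (ξ i))
    (hlaw : ∀ i, HasLaw (ξ i) (gaussianReal 0 1) P) (hind : iIndepFun ξ P)
    {C : ℕ → Finset ι} (hC : Monotone C) {γ : ι → ℝ} {σ : ℝ} (hσ : 0 ≤ σ)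
    (hγ : ∀ N, ∑ i ∈ C N, γ i ^ 2 ≤ σ ^ 2) {t : ℝ} (ht : 0 < t) :
    P {ω | ∃ N, t ≤ |∑ i ∈ C N, γ i * ξ i ω|} ≤ ENNReal.ofReal (σ / t) := by
  set M : ℕ → Ω → ℝ := fun N ω => ∑ i ∈ C N, γ i * ξ i ω with hMdef
  have hM : Martingale M (setFiltration hm hC) P := martingale_sum_gaussian hm hlaw hind hC γ
  have hsub : Submartingale (fun N ω => |M N ω|) (setFiltration hm hC) P :=
    hM.submartingale.sup hM.neg.submartingale
  -- Doob's inequality concerns a finite horizon; the events up to time `n` increase to the full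
  -- one.
  let A : ℕ → Set Ω := fun n => {ω | ∃ N ≤ n, t ≤ |M N ω|}
  have hA : {ω | ∃ N, t ≤ |M N ω|} = ⋃ n, A n := by
    ext ω
    simp only [Set.mem_ofPred_eq, Set.mem_iUnion, A]
    exact ⟨fun ⟨N, h⟩ => ⟨N, N, le_rfl, h⟩, fun ⟨n, N, _, h⟩ => ⟨N, h⟩⟩
  have hmono : Monotone A := fun m n hmn ω ⟨N, h1, h2⟩ => ⟨N, h1.trans hmn, h2⟩
  rw [hA, hmono.measure_iUnion]
  refine iSup_le fun n => ?_
  have hmax := maximal_ineq hsub (fun N ω => abs_nonneg _) (ε := t.toNNReal) n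
  have hAn : {ω | ((t.toNNReal : ℝ≥0) : ℝ) ≤
      (Finset.range (n + 1)).sup' Finset.nonempty_range_add_one fun k => |M k ω|} = A n := by
    ext ω
    simp [A, Real.coe_toNNReal t ht.le, Finset.le_sup'_iff]
  rw [hAn] at hmax
  have hint : Integrable (fun ω => |M n ω|) P := (hM.integrable n).abs
  have hle : ENNReal.ofReal (∫ ω in A n, |M n ω| ∂P) ≤ ENNReal.ofReal σ := by
    refine (ENNReal.ofReal_le_ofReal
      (setIntegral_le_integral hint (Eventually.of_forall fun ω => abs_nonneg _))).trans ?_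
    rw [ofReal_integral_eq_lintegral_ofReal hint (Eventually.of_forall fun ω => abs_nonneg _)]
    refine le_trans (le_of_eq ?_) (lintegral_enorm_sum_gaussian_le hlaw hind (C n) hσ (hγ n))
    simp [Real.enorm_eq_ofReal_abs, M]
  rw [ENNReal.ofReal_div_of_pos ht, ENNReal.le_div_iff_mul_le (by simp [ht]) (by simp),
    mul_comm]
  exact hmax.trans hle

end Martingale

/-! ### Criteria for convergence in distribution. -/

section Distribution

/-- Convergence in distribution of vectors follows from the convergence of the expectations
`E exp (i ⟨X, t⟩)`. -/
theorem tendstoInDistribution_of_tendsto_integral_cexp {E Ω Ω' : Type*} [NormedAddCommGroup E]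
    [InnerProductSpace ℝ E] [FiniteDimensional ℝ E] [MeasurableSpace E] [BorelSpace E]
    [MeasurableSpace Ω] [MeasurableSpace Ω'] {P : Measure Ω} [IsProbabilityMeasure P]
    {P' : Measure Ω'} [IsProbabilityMeasure P'] {X : ℕ → Ω → E} {Z : Ω' → E}
    (hX : ∀ L, AEMeasurable (X L) P) (hZ : AEMeasurable Z P')
    (h : ∀ t : E, Tendsto (fun L => ∫ ω, Complex.exp ((inner ℝ (X L ω) t : ℂ) * Complex.I) ∂P)
      atTop (𝓝 (∫ ω, Complex.exp ((inner ℝ (Z ω) t : ℂ) * Complex.I) ∂P'))) :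
    TendstoInDistribution X atTop Z (fun _ => P) P' := by
  refine ⟨hX, hZ, ProbabilityMeasure.tendsto_of_tendsto_charFun fun t => ?_⟩
  simp only [ProbabilityMeasure.coe_mk, charFun_apply]
  rw [integral_map hZ (by fun_prop)]
  refine (h t).congr fun L => ?_
  rw [integral_map (hX L) (by fun_prop)]

/-- Convergence in distribution may be checked on approximations that are uniformly close in
mean. -/
theorem tendstoInDistribution_of_approx {E Ω Ω' : Type*} [PseudoMetricSpace E]
    [MeasurableSpace E] [BorelSpace E]
    [MeasurableSpace Ω] [MeasurableSpace Ω'] {P : Measure Ω} [IsProbabilityMeasure P]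
    {P' : Measure Ω'} [IsProbabilityMeasure P'] {X : ℕ → Ω → E} {Z : Ω' → E}
    {Y : ℕ → ℕ → Ω → E} {T : ℕ → Ω' → E}
    (hYT : ∀ K, TendstoInDistribution (fun L => Y L K) atTop (T K) (fun _ => P) P')
    (hYX : ∀ L, ∀ᵐ ω ∂P, Tendsto (fun K => Y L K ω) atTop (𝓝 (X L ω)))
    (hTZ : ∀ᵐ ω ∂P', Tendsto (fun K => T K ω) atTop (𝓝 (Z ω)))
    {ε : ℕ → ℝ≥0∞} (hε : Tendsto ε atTop (𝓝 0))
    (hdist : ∀ L K, ∫⁻ ω, edist (Y L K ω) (X L ω) ∂P ≤ ε K) :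
    TendstoInDistribution X atTop Z (fun _ => P) P' := by
  have hYm : ∀ L K, AEMeasurable (Y L K) P := fun L K => (hYT K).forall_aemeasurable L
  have hTm : ∀ K, AEMeasurable (T K) P' := fun K => (hYT K).aemeasurable_limit
  have hXm : ∀ L, AEMeasurable (X L) P := fun L =>
    aemeasurable_of_tendsto_metrizable_ae' (hYm L) (hYX L)
  have hZm : AEMeasurable Z P' := aemeasurable_of_tendsto_metrizable_ae' hTm hTZ
  refine ⟨hXm, hZm, tendsto_iff_forall_lipschitz_integral_tendsto.2 ?_⟩
  rintro f ⟨B, hB⟩ ⟨Λ, hΛ⟩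
  have hf : Measurable f := hΛ.continuous.measurable
  have hfs := hΛ.continuous
  let fb : BoundedContinuousFunction E ℝ := ⟨⟨f, hfs⟩, ⟨B, hB⟩⟩
  have hfb : ∀ x, ‖f x‖ ≤ ‖fb‖ := fun x => fb.norm_coe_le_norm x
  simp only [ProbabilityMeasure.coe_mk]
  rw [integral_map hZm hf.aestronglyMeasurable]
  have hintX : ∀ {Ω₁ : Type _} [MeasurableSpace Ω₁] {Q : Measure Ω₁} [IsProbabilityMeasure Q]
      {U : Ω₁ → E}, AEMeasurable U Q → Integrable (fun ω => f (U ω)) Q := by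
    intro Ω₁ _ Q _ U hU
    exact Integrable.of_bound (hf.comp_aemeasurable hU).aestronglyMeasurable ‖fb‖
      (Eventually.of_forall fun ω => hfb _)
  have hlim : ∀ K, Tendsto (fun L => ∫ ω, f (Y L K ω) ∂P) atTop (𝓝 (∫ ω, f (T K ω) ∂P')) := by
    intro K
    have h := (tendsto_iff_forall_lipschitz_integral_tendsto.1 (hYT K).tendsto) f ⟨B, hB⟩ ⟨Λ, hΛ⟩
    simp only [ProbabilityMeasure.coe_mk] at h
    rw [integral_map (hTm K) hf.aestronglyMeasurable] at h
    refine h.congr fun L => ?_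
    rw [integral_map (hYm L K) hf.aestronglyMeasurable]
  have hlimT : Tendsto (fun K => ∫ ω, f (T K ω) ∂P') atTop (𝓝 (∫ ω, f (Z ω) ∂P')) := by
    refine tendsto_integral_of_dominated_convergence (fun _ => ‖fb‖)
      (fun K => (hf.comp_aemeasurable (hTm K)).aestronglyMeasurable) (integrable_const _)
      (fun K => Eventually.of_forall fun ω => hfb _) ?_
    filter_upwards [hTZ] with ω h
    exact (hfs.tendsto _).comp h
  have hclose : ∀ L K, edist (∫ ω, f (Y L K ω) ∂P) (∫ ω, f (X L ω) ∂P) ≤ Λ * ε K := by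
    intro L K
    rw [edist_eq_enorm_sub, ← integral_sub (hintX (hYm L K)) (hintX (hXm L))]
    refine (enorm_integral_le_lintegral_enorm _).trans ?_
    calc ∫⁻ ω, ‖f (Y L K ω) - f (X L ω)‖ₑ ∂P
        ≤ ∫⁻ ω, Λ * edist (Y L K ω) (X L ω) ∂P := by
          refine lintegral_mono fun ω => ?_
          rw [← edist_eq_enorm_sub]
          exact hΛ _ _
      _ = Λ * ∫⁻ ω, edist (Y L K ω) (X L ω) ∂P := lintegral_const_mul' _ _ (by simp)
      _ ≤ Λ * ε K := by gcongr; exact hdist L K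
  have hΛε : Tendsto (fun K => (Λ : ℝ≥0∞) * ε K) atTop (𝓝 0) := by
    simpa using ENNReal.Tendsto.const_mul hε (Or.inr (by simp : (Λ : ℝ≥0∞) ≠ ∞))
  rw [EMetric.tendsto_atTop]
  intro δ hδ
  have hδ3 : 0 < δ / 3 := ENNReal.div_pos hδ.ne' (by norm_num)
  -- `K` is fixed before `L`, which is legitimate because `hclose` is uniform in `L`.
  obtain ⟨K, hK1, hK2⟩ := (((ENNReal.tendsto_nhds_zero.1 hΛε) _ hδ3).and
    ((EMetric.tendsto_nhds.1 hlimT) _ hδ3)).exists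
  obtain ⟨L₀, hL⟩ := (EMetric.tendsto_atTop.1 (hlim K)) _ hδ3
  refine ⟨L₀, fun L hLL => ?_⟩
  rw [integral_map (hXm L) hf.aestronglyMeasurable]
  calc edist (∫ ω, f (X L ω) ∂P) (∫ ω, f (Z ω) ∂P')
      ≤ edist (∫ ω, f (X L ω) ∂P) (∫ ω, f (Y L K ω) ∂P) +
        edist (∫ ω, f (Y L K ω) ∂P) (∫ ω, f (T K ω) ∂P') +
        edist (∫ ω, f (T K ω) ∂P') (∫ ω, f (Z ω) ∂P') := edist_triangle4 _ _ _ _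
    _ < δ / 3 + δ / 3 + δ / 3 := by
      refine ENNReal.add_lt_add (ENNReal.add_lt_add_of_le_of_lt ?_ ?_ (hL L hLL)) hK2
      · exact edist_ne_top _ _
      · exact (edist_comm _ _).trans_le ((hclose L K).trans hK1)
    _ = δ := ENNReal.add_thirds δ

end Distribution

/-! ### Power series indexed by words and their `C^r` bounds. -/

/-- Words in the letters `1, …, d`; they index the monomials in noncommuting variables. -/
abbrev Word (d : ℕ) : Type := Σ k : ℕ, Fin k → Fin d

/-- The monomial `∏_l x_{w_l}` of a word `w`. -/
def mono {d : ℕ} (w : Word d) (x : Fin d → ℝ) : ℝ := ∏ l, x (w.2 l)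

/-- The sum of the power series with coefficients `z`. -/
def field {d : ℕ} (z : Word d → ℝ) (x : Space d) : ℝ := ∑' w, z w * mono w x

/-- The power series with coefficients `z` converges absolutely everywhere. -/
def Decays {d : ℕ} (z : Word d → ℝ) : Prop :=
  ∀ B : ℝ, 0 ≤ B → Summable fun w => |z w| * B ^ w.1

section Monomials

open scoped ContDiff

variable {d : ℕ}

theorem abs_mono_le (w : Word d) {x : Fin d → ℝ} {B : ℝ} (hx : ∀ j, |x j| ≤ B) :
    |mono w x| ≤ B ^ w.1 := by
  rw [mono, Finset.abs_prod]
  refine (Finset.prod_le_prod (fun _ _ => abs_nonneg _) fun l _ => hx (w.2 l)).trans ?_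
  simp

theorem Decays.sub {z z' : Word d → ℝ} (h : Decays z) (h' : Decays z') :
    Decays fun w => z w - z' w := by
  intro B hB
  refine ((h B hB).add (h' B hB)).of_nonneg_of_le (fun w => by positivity) fun w => ?_
  rw [← add_mul]
  gcongr
  exact abs_sub _ _

theorem Decays.of_abs_le {z z' : Word d → ℝ} (h : Decays z) (h' : ∀ w, |z' w| ≤ |z w|) :
    Decays z' := by
  intro B hB
  refine (h B hB).of_nonneg_of_le (fun w => by positivity) fun w => ?_
  exact mul_le_mul_of_nonneg_right (h' w) (by positivity)

theorem Decays.summable {z : Word d → ℝ} (h : Decays z) (x : Fin d → ℝ) :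
    Summable fun w => z w * mono w x := by
  have hx : ∀ j, |x j| ≤ ∑ i, |x i| := fun j =>
    Finset.single_le_sum (f := fun i => |x i|) (fun _ _ => abs_nonneg _) (Finset.mem_univ j)
  refine .of_norm_bounded (h (∑ i, |x i|) (Finset.sum_nonneg fun _ _ => abs_nonneg _))
    fun w => ?_
  rw [norm_mul, Real.norm_eq_abs, Real.norm_eq_abs]
  gcongr
  exact abs_mono_le w hx

theorem field_sub {z z' : Word d → ℝ} (h : Decays z) (h' : Decays z') (x : Space d) :
    field (fun w => z w - z' w) x = field z x - field z' x := by
  simp only [field, sub_mul]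
  exact (h.summable x).tsum_sub (h'.summable x)

theorem contDiff_mono (w : Word d) {n : WithTop ℕ∞} : ContDiff ℝ n fun x : Space d => mono w x := by
  unfold mono
  exact contDiff_prod fun l _ => (EuclideanSpace.proj (𝕜 := ℝ) (w.2 l)).contDiff

theorem norm_iteratedFDeriv_proj_le (j : Fin d) (m : ℕ) {x : Space d} {ρ : ℝ} (hρ : 1 ≤ ρ)
    (hx : ‖x‖ ≤ ρ) : ‖iteratedFDeriv ℝ m (fun x : Space d => x j) x‖ ≤ ρ := by
  have hj : ∀ y : Space d, ‖y j‖ ≤ ‖y‖ := fun y => PiLp.norm_apply_le y j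
  have hL : fderiv ℝ (fun x : Space d => x j) = fun _ => EuclideanSpace.proj (𝕜 := ℝ) j := by
    ext1 y
    exact (EuclideanSpace.proj (𝕜 := ℝ) j : Space d →L[ℝ] ℝ).fderiv
  match m with
  | 0 =>
    rw [norm_iteratedFDeriv_zero]
    exact (hj x).trans hx
  | 1 =>
    rw [norm_iteratedFDeriv_one, hL]
    refine le_trans (ContinuousLinearMap.opNorm_le_bound _ zero_le_one fun y => ?_) hρ
    rw [one_mul]
    exact hj y
  | m + 2 =>
    rw [← norm_iteratedFDeriv_fderiv, hL, iteratedFDeriv_const_of_ne (Nat.succ_ne_zero m)]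
    simp only [Pi.zero_apply, norm_zero]
    linarith

theorem norm_iteratedFDeriv_mul_le_of_bounds {E : Type*} [NormedAddCommGroup E] [NormedSpace ℝ E]
    {f g : E → ℝ} {r m : ℕ} (hm : m ≤ r) (hf : ContDiff ℝ ∞ f) (hg : ContDiff ℝ ∞ g) {x : E}
    {A B : ℝ} (hA : ∀ i ≤ r, ‖iteratedFDeriv ℝ i f x‖ ≤ A)
    (hB : ∀ i ≤ r, ‖iteratedFDeriv ℝ i g x‖ ≤ B) :
    ‖iteratedFDeriv ℝ m (fun y => f y * g y) x‖ ≤ 2 ^ r * (A * B) := by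
  have hA0 : 0 ≤ A := (norm_nonneg _).trans (hA 0 (Nat.zero_le _))
  have hB0 : 0 ≤ B := (norm_nonneg _).trans (hB 0 (Nat.zero_le _))
  refine (norm_iteratedFDeriv_mul_le (N := ∞) hf hg x (by exact_mod_cast le_top)).trans ?_
  calc ∑ i ∈ Finset.range (m + 1), (m.choose i : ℝ) * ‖iteratedFDeriv ℝ i f x‖ *
        ‖iteratedFDeriv ℝ (m - i) g x‖
      ≤ ∑ i ∈ Finset.range (m + 1), (m.choose i : ℝ) * (A * B) := by
        refine Finset.sum_le_sum fun i hi => ?_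
        rw [mul_assoc]
        have him := Finset.mem_range_succ_iff.1 hi
        gcongr
        · exact hA i (him.trans hm)
        · exact hB _ ((Nat.sub_le _ _).trans hm)
    _ = 2 ^ m * (A * B) := by
        rw [← Finset.sum_mul]
        congr 1
        exact_mod_cast Nat.sum_range_choose m
    _ ≤ 2 ^ r * (A * B) := by
        gcongr
        norm_num

/-- Peeling off one letter costs a factor `2 ^ r * ρ` by the Leibniz rule. Only geometric growth in
the length matters, since the coefficients decay faster than any geometric sequence. -/
theorem norm_iteratedFDeriv_mono_le (w : Word d) {r m : ℕ} (hm : m ≤ r) {x : Space d} {ρ : ℝ}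
    (hρ : 1 ≤ ρ) (hx : ‖x‖ ≤ ρ) :
    ‖iteratedFDeriv ℝ m (fun x : Space d => mono w x) x‖ ≤ (2 ^ r * ρ) ^ w.1 := by
  obtain ⟨k, w⟩ := w
  induction k generalizing m with
  | zero =>
    simp only [mono, Finset.univ_eq_empty, Finset.prod_empty, pow_zero]
    rcases m with _ | m
    · simp
    · rw [iteratedFDeriv_const_of_ne (Nat.succ_ne_zero m)]
      simp
  | succ k ih =>
    have e : (fun x : Space d => mono ⟨k + 1, w⟩ x) =
        fun x : Space d => x (w 0) * mono ⟨k, fun l => w l.succ⟩ x := by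
      ext x
      simp [mono, Fin.prod_univ_succ]
    rw [e]
    refine (norm_iteratedFDeriv_mul_le_of_bounds hm (EuclideanSpace.proj (𝕜 := ℝ) (w 0)).contDiff
      (contDiff_mono _) (fun i _ => norm_iteratedFDeriv_proj_le _ i hρ hx)
      (fun i hi => ih hi (fun l => w l.succ))).trans (le_of_eq ?_)
    ring

/-- The monomials, cut off outside a neighborhood of a ball, have derivatives that are bounded on
the whole space. -/
theorem exists_cutoff_mono_bound (d r : ℕ) {R : ℝ} (hR : 0 < R) :
    ∃ (χ : Space d → ℝ) (C B : ℝ), 0 ≤ C ∧ 0 ≤ B ∧ ContDiff ℝ ∞ χ ∧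
      (∀ x : Space d, ‖x‖ < R + 1 → χ x = 1) ∧
      ∀ (w : Word d) (m : ℕ) (x : Space d), m ≤ r →
        ‖iteratedFDeriv ℝ m (fun y : Space d => χ y * mono w y) x‖ ≤ C * B ^ w.1 := by
  -- The cutoff equals `1` on a neighborhood of the ball of radius `R`, so derivatives on the closed
  -- ball are not affected; the monomials need only be bounded up to radius `R + 2`.
  let χ : ContDiffBump (0 : Space d) := ⟨R + 1, R + 2, by linarith, by linarith⟩
  have hχ : ContDiff ℝ ∞ χ := χ.contDiff
  have hb : ∀ i : ℕ, ∃ A : ℝ, ∀ x, ‖iteratedFDeriv ℝ i χ x‖ ≤ A := fun i =>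
    (χ.hasCompactSupport.iteratedFDeriv (𝕜 := ℝ) i).exists_bound_of_continuous
      (hχ.continuous_iteratedFDeriv (by exact_mod_cast le_top))
  choose A hA using hb
  have hA0 : ∀ i, 0 ≤ A i := fun i => (norm_nonneg _).trans (hA i 0)
  have hAle : ∀ i ≤ r, ∀ x, ‖iteratedFDeriv ℝ i χ x‖ ≤ ∑ j ∈ Finset.range (r + 1), A j :=
    fun i hi x => (hA i x).trans (Finset.single_le_sum (f := A) (fun j _ => hA0 j)
      (Finset.mem_range_succ_iff.2 hi))
  have hS0 : 0 ≤ ∑ j ∈ Finset.range (r + 1), A j := Finset.sum_nonneg fun j _ => hA0 j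
  refine ⟨χ, 2 ^ r * ∑ j ∈ Finset.range (r + 1), A j, 2 ^ r * (R + 2), by positivity,
    by positivity, hχ, fun x hx => ?_, fun w m x hm => ?_⟩
  · refine χ.one_of_mem_closedBall ?_
    rw [mem_closedBall_zero_iff]
    exact hx.le
  · rcases le_or_gt ‖x‖ (R + 2) with hx | hx
    · rw [mul_assoc]
      exact norm_iteratedFDeriv_mul_le_of_bounds hm hχ (contDiff_mono w)
        (fun i hi => hAle i hi x)
        (fun i hi => norm_iteratedFDeriv_mono_le w hi (by linarith) hx)
    · have hz : (fun y : Space d => χ y * mono w y) =ᶠ[𝓝 x] fun _ => 0 := by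
        have ho : {y : Space d | R + 2 < ‖y‖} ∈ 𝓝 x :=
          (isOpen_lt continuous_const continuous_norm).mem_nhds hx
        filter_upwards [ho] with y hy
        rw [χ.zero_of_le_dist, zero_mul]
        rw [dist_zero_right]
        exact le_of_lt hy
      rw [(hz.iteratedFDeriv ℝ m).eq_of_nhds, iteratedFDeriv_fun_zero]
      simp only [Pi.zero_apply, norm_zero]
      positivity

/-- Termwise differentiation is applied to the cut-off series, whose terms have bounds on the whole
space; it coincides with `field z` near `x`. -/
theorem field_local {r : ℕ} {R : ℝ} {χ : Space d → ℝ} {C B : ℝ} (hB : 0 ≤ B)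
    (hχ : ContDiff ℝ ∞ χ) (hχ1 : ∀ x : Space d, ‖x‖ < R + 1 → χ x = 1)
    (hbound : ∀ (w : Word d) (m : ℕ) (x : Space d), m ≤ r →
        ‖iteratedFDeriv ℝ m (fun y : Space d => χ y * mono w y) x‖ ≤ C * B ^ w.1)
    {z : Word d → ℝ} (hz : Decays z) {x : Space d} (hx : ‖x‖ ≤ R) :
    ContDiffAt ℝ r (field z) x ∧
      ∀ m ≤ r, ‖iteratedFDeriv ℝ m (field z) x‖ ≤ C * ∑' w, |z w| * B ^ w.1 := by
  let f : Word d → Space d → ℝ := fun w y => z w * (χ y * mono w y)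
  have hf : ∀ w, ContDiff ℝ ∞ (f w) := fun w => contDiff_const.mul (hχ.mul (contDiff_mono w))
  have hfb : ∀ (m : ℕ) (w : Word d) (y : Space d), (m : ℕ∞) ≤ (r : ℕ∞) →
      ‖iteratedFDeriv ℝ m (f w) y‖ ≤ C * (|z w| * B ^ w.1) := by
    intro m w y hm
    have e : f w = z w • fun y : Space d => χ y * mono w y := rfl
    rw [e, iteratedFDeriv_const_smul_apply
      ((hχ.mul (contDiff_mono w)).contDiffAt.of_le (by exact_mod_cast le_top)), norm_smul,
      Real.norm_eq_abs]
    calc |z w| * _ ≤ |z w| * (C * B ^ w.1) := by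
          gcongr
          exact hbound w m y (by exact_mod_cast hm)
      _ = _ := by ring
  have hsum : Summable fun w => C * (|z w| * B ^ w.1) := (hz B hB).mul_left C
  have hfr : ∀ w, ContDiff ℝ ((r : ℕ∞) : WithTop ℕ∞) (f w) := fun w =>
    (hf w).of_le (by exact_mod_cast le_top)
  have heq : field z =ᶠ[𝓝 x] fun y => ∑' w, f w y := by
    have ho : {y : Space d | ‖y‖ < R + 1} ∈ 𝓝 x :=
      (isOpen_lt continuous_norm continuous_const).mem_nhds (by
        change ‖x‖ < R + 1
        linarith)
    filter_upwards [ho] with y hy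
    simp only [field, f, hχ1 y hy, one_mul]
  constructor
  · exact (contDiff_tsum (v := fun _ w => C * (|z w| * B ^ w.1)) hfr (fun _ _ => hsum)
      hfb).contDiffAt.congr_of_eventuallyEq heq
  · intro m hm
    rw [(heq.iteratedFDeriv ℝ m).eq_of_nhds,
      iteratedFDeriv_tsum_apply (v := fun _ w => C * (|z w| * B ^ w.1)) hfr (fun _ _ => hsum)
      hfb (by exact_mod_cast hm), ← tsum_mul_left]
    exact tsum_of_norm_bounded hsum.hasSum fun w => hfb m w x (by exact_mod_cast hm)

theorem contDiff_field (r : ℕ) {z : Word d → ℝ} (hz : Decays z) : ContDiff ℝ r (field z) := by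
  rw [contDiff_iff_contDiffAt]
  intro x
  obtain ⟨χ, C, B, -, hB, hχ, hχ1, hbound⟩ :=
    exists_cutoff_mono_bound d r (R := ‖x‖ + 1) (by positivity)
  exact (field_local hB hχ hχ1 hbound hz (by linarith)).1

theorem CrBall.derivative_ofFun {r : ℕ} {R : ℝ} (hR : 0 < R) {g : Space d → ℝ}
    (hg : ContDiff ℝ r g) {k : ℕ} (hk : k ≤ r) (x : ball d R) :
    (CrBall.ofFun r R g).derivative k x = iteratedFDeriv ℝ k g x := by
  have hu : UniqueDiffOn ℝ (ball d R) :=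
    uniqueDiffOn_convex (convex_closedBall _ _)
      ⟨0, Metric.ball_subset_interior_closedBall (Metric.mem_ball_self hR)⟩
  have h : (CrBall.ofFun r R g).toFun = (ball d R).domRestrict g := by
    rw [CrBall.ofFun, dif_pos hg.contDiffOn]
  rw [CrBall.derivative, h, ← iteratedFDerivWithin_eq_iteratedFDeriv hu
    (hg.contDiffAt.of_le (by exact_mod_cast hk)) x.2]
  exact iteratedFDerivWithin_congr (fun y hy =>
    Subtype.val_injective.extend_apply ((ball d R).domRestrict g) 0 ⟨y, hy⟩) x.2 k

/-- By linearity, the derivatives of the difference are those of the field with coefficients `z -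
z'`. This is the link between the coefficients and the metric of `CrBall`. -/
theorem exists_dist_field_le (d r : ℕ) {R : ℝ} (hR : 0 < R) :
    ∃ C B : ℝ, 0 ≤ C ∧ 0 ≤ B ∧ ∀ z z' : Word d → ℝ, Decays z → Decays z' →
      dist (CrBall.ofFun r R (field z)) (CrBall.ofFun r R (field z')) ≤
        C * ∑' w, |z w - z' w| * B ^ w.1 := by
  obtain ⟨χ, C, B, hC, hB, hχ, hχ1, hbound⟩ := exists_cutoff_mono_bound d r hR
  refine ⟨C, B, hC, hB, fun z z' hz hz' => ?_⟩
  have h0 : 0 ≤ C * ∑' w, |z w - z' w| * B ^ w.1 :=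
    mul_nonneg hC (tsum_nonneg fun w => by positivity)
  change dist (CrBall.jet _) (CrBall.jet _) ≤ _
  rw [dist_pi_le_iff h0]
  intro k
  rw [ContinuousMap.dist_le h0]
  intro x
  have hk : (k : ℕ) ≤ r := Nat.lt_succ_iff.mp k.2
  change dist (CrBall.derivative _ _ _) (CrBall.derivative _ _ _) ≤ _
  rw [CrBall.derivative_ofFun hR (contDiff_field r hz) hk,
    CrBall.derivative_ofFun hR (contDiff_field r hz') hk, dist_eq_norm]
  have e : field (fun w => z w - z' w) = field z - field z' := funext (field_sub hz hz')
  have h := (field_local hB hχ hχ1 hbound (hz.sub hz') (mem_closedBall_zero_iff.1 x.2)).2 k hk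
  rw [e, iteratedFDeriv_sub ((contDiff_field r hz).of_le (by exact_mod_cast hk))
    ((contDiff_field r hz').of_le (by exact_mod_cast hk))] at h
  exact h

end Monomials

/-! ### Power series expansion of the two fields. -/

section Expansion

variable {d : ℕ}

/-- There are `d ^ k` words of length `k`. -/
theorem summable_word {f : ℕ → ℝ} (hf : ∀ k, 0 ≤ f k) (h : Summable fun k => (d : ℝ) ^ k * f k) :
    Summable fun w : Word d => f w.1 := by
  rw [summable_sigma_of_nonneg fun w => hf w.1]
  refine ⟨fun k => Summable.of_finite, ?_⟩
  simpa [tsum_fintype, mul_comm] using h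

theorem summable_word_factorial {A B : ℝ} (hA : 0 ≤ A) (hB : 0 ≤ B) :
    Summable fun w : Word d => A ^ w.1 / w.1.factorial * B ^ w.1 := by
  refine summable_word (f := fun k => A ^ k / k.factorial * B ^ k) (fun k => by positivity) ?_
  refine (Real.summable_pow_div_factorial (d * A * B)).congr fun k => ?_
  rw [mul_pow, mul_pow]
  ring

theorem decays_of_abs_le {z : Word d → ℝ} {A Λ : ℝ} (hΛ : 0 ≤ Λ)
    (h : ∀ w, |z w| ≤ A * (Λ ^ w.1 / w.1.factorial)) : Decays z := by
  intro B hB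
  refine ((summable_word_factorial (d := d) hΛ hB).mul_left A).of_nonneg_of_le
    (fun w => by positivity) fun w => ?_
  rw [← mul_assoc]
  exact mul_le_mul_of_nonneg_right (h w) (by positivity)

/-- The coefficient of the word `w` in the expansion of `x ↦ e^{i x·ξ}`. -/
def symbol (w : Word d) (ξ : Fin d → ℝ) : ℂ :=
  Complex.I ^ w.1 / (w.1.factorial : ℂ) * (mono w ξ : ℂ)

theorem norm_symbol_le (w : Word d) {ξ : Fin d → ℝ} {Λ : ℝ} (h : ∀ j, |ξ j| ≤ Λ) :
    ‖symbol w ξ‖ ≤ Λ ^ w.1 / w.1.factorial := by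
  have := abs_mono_le w h
  rw [symbol, norm_mul, norm_div, norm_pow, Complex.norm_I, one_pow, Complex.norm_natCast,
    Complex.norm_real, Real.norm_eq_abs, div_mul_eq_mul_div, one_mul]
  gcongr

theorem continuous_symbol (w : Word d) : Continuous (symbol w) := by
  unfold symbol mono
  fun_prop

theorem symbol_neg (w : Word d) (ξ : Fin d → ℝ) :
    symbol w (-ξ) = (starRingEnd ℂ) (symbol w ξ) := by
  have h : mono w (-ξ) = (-1) ^ w.1 * mono w ξ := by
    simp only [mono, Pi.neg_apply, Finset.prod_neg]
    simp
  simp only [symbol, h, map_mul, map_div₀, map_pow, Complex.conj_I, Complex.conj_ofReal,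
    map_natCast]
  rw [neg_pow Complex.I]
  push_cast
  ring

theorem hasSum_mono_mul_symbol (x ξ : Fin d → ℝ) :
    HasSum (fun w => (mono w x : ℂ) * symbol w ξ)
      (Complex.exp (Complex.I * ((∑ j, x j * ξ j : ℝ) : ℂ))) := by
  have hx : ∀ j, |x j| ≤ ∑ i, |x i| := fun j =>
    Finset.single_le_sum (f := fun i => |x i|) (fun _ _ => abs_nonneg _) (Finset.mem_univ j)
  have hξ : ∀ j, |ξ j| ≤ ∑ i, |ξ i| := fun j =>
    Finset.single_le_sum (f := fun i => |ξ i|) (fun _ _ => abs_nonneg _) (Finset.mem_univ j)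
  have hsum : Summable fun w => (mono w x : ℂ) * symbol w ξ := by
    refine .of_norm_bounded (summable_word_factorial (d := d) (A := ∑ i, |ξ i|)
      (B := ∑ i, |x i|) (Finset.sum_nonneg fun _ _ => abs_nonneg _)
      (Finset.sum_nonneg fun _ _ => abs_nonneg _)) fun w => ?_
    rw [norm_mul, mul_comm, Complex.norm_real, Real.norm_eq_abs]
    gcongr
    · exact norm_symbol_le w hξ
    · exact abs_mono_le w hx
  have hexp : HasSum (fun k : ℕ => (Complex.I * ((∑ j, x j * ξ j : ℝ) : ℂ)) ^ k / k.factorial)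
      (Complex.exp (Complex.I * ((∑ j, x j * ξ j : ℝ) : ℂ))) := by
    rw [Complex.exp_eq_exp_ℂ]
    exact NormedSpace.expSeries_div_hasSum_exp _
  refine HasSum.sigma_of_hasSum hexp (fun k => ?_) hsum
  have hk : (Complex.I * ((∑ j, x j * ξ j : ℝ) : ℂ)) ^ k / k.factorial =
      ∑ w : Fin k → Fin d, (mono ⟨k, w⟩ x : ℂ) * symbol ⟨k, w⟩ ξ := by
    -- The power of the sum is expanded into words without grouping equal monomials, so no
    -- multinomial coefficients appear.
    rw [mul_pow, ← Complex.ofReal_pow, Fintype.sum_pow, Complex.ofReal_sum, mul_div_right_comm,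
      Finset.mul_sum]
    refine Finset.sum_congr rfl fun w _ => ?_
    rw [Finset.prod_mul_distrib]
    simp only [symbol, mono]
    push_cast
    ring
  rw [hk]
  exact hasSum_fintype _

/-- The coefficient of the field `rescaledPotential` that corresponds to the symbol `g`. -/
def trigCoef (Λ : ℝ) (L : ℕ) (a : (Fin d → ℤ) → ℂ) (q : Torus d) (g : (Fin d → ℝ) → ℂ) : ℝ :=
  (((1 / Real.sqrt ((frequencies d L).card : ℝ) : ℝ) : ℂ) *
    ∑ n ∈ frequencies d L, a n * (character n q * g fun j => Λ * n j / L)).re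

/-- The coefficient of `phiHat` that corresponds to the symbol `g`. -/
def cubeCoef (Λ : ℝ) (g : (Fin d → ℝ) → ℂ) (n : Fin d → ℤ) : ℝ :=
  ((((2 * Λ) ^ d)⁻¹ : ℝ) * ∫ ξ in cube d Λ, g ξ * phi Λ n ξ : ℂ).re

theorem norm_character (n : Fin d → ℤ) (q : Torus d) : ‖character n q‖ = 1 := by
  rw [character, norm_prod]
  exact Finset.prod_eq_one fun j _ => Circle.norm_coe _

theorem character_add_coe (n : Fin d → ℤ) (q : Torus d) (y : Fin d → ℝ) :
    character n (fun j => q j + (y j : AddCircle (2 * Real.pi))) =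
      character n q * Complex.exp (Complex.I * ((∑ j, y j * n j : ℝ) : ℂ)) := by
  have h : ∀ j, (fourier (n j) (q j + (y j : AddCircle (2 * Real.pi))) : ℂ) =
      fourier (n j) (q j) * Complex.exp (Complex.I * ((y j * n j : ℝ) : ℂ)) := by
    intro j
    have hpi : (Real.pi : ℂ) ≠ 0 := by exact_mod_cast Real.pi_ne_zero
    rw [fourier_apply, smul_add, AddCircle.toCircle_add, Circle.coe_mul, ← fourier_apply,
      ← fourier_apply, fourier_coe_apply]
    congr 2
    push_cast
    field_simp
  simp only [character, h, Finset.prod_mul_distrib]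
  rw [← Complex.exp_sum, ← Finset.mul_sum, Complex.ofReal_sum]

theorem abs_freq_div_le {Λ : ℝ} (hΛ : 0 ≤ Λ) {L : ℕ} {n : Fin d → ℤ} (hn : n ∈ frequencies d L)
    (j : Fin d) : |Λ * n j / L| ≤ Λ := by
  have h := ((mem_frequencies n).1 hn).2 j
  have h' : |(n j : ℝ)| ≤ L := by exact_mod_cast h
  rw [abs_div, abs_mul, abs_of_nonneg hΛ, Nat.abs_cast]
  exact div_le_of_le_mul₀ (Nat.cast_nonneg L) hΛ (by gcongr)

/-- The points `Λ n / L` lie in the cube, where `symbol w` is at most `Λ^k / k!`. The constant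
depends on `L` and on the values `a`, so this is only a pathwise statement. -/
theorem decays_trigCoef {Λ : ℝ} (hΛ : 0 ≤ Λ) (L : ℕ) (a : (Fin d → ℤ) → ℂ) (q : Torus d) :
    Decays fun w => trigCoef Λ L a q (symbol w) := by
  refine decays_of_abs_le (A := ‖((1 / Real.sqrt ((frequencies d L).card : ℝ) : ℝ) : ℂ)‖ *
    ∑ n ∈ frequencies d L, ‖a n‖) hΛ fun w => ?_
  refine (Complex.abs_re_le_norm _).trans ?_
  rw [norm_mul, mul_assoc, Finset.sum_mul]
  gcongr
  refine (norm_sum_le _ _).trans (Finset.sum_le_sum fun n hn => ?_)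
  rw [norm_mul, norm_mul, norm_character, one_mul]
  gcongr
  exact norm_symbol_le w (abs_freq_div_le hΛ hn)

theorem rescaledPotential_eq_field (Λ : ℝ) (L : ℕ) (a : (Fin d → ℤ) → ℂ) (q : Torus d) :
    rescaledPotential Λ L a q = field fun w => trigCoef Λ L a q (symbol w) := by
  ext x
  rw [rescaledPotential, trigPotential, trigSum, field]
  have h : HasSum (fun w => ((1 / Real.sqrt ((frequencies d L).card : ℝ) : ℝ) : ℂ) *
      ∑ n ∈ frequencies d L, a n * (character n q * ((mono w x : ℂ) *
        symbol w fun j => Λ * n j / L)))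
      (((1 / Real.sqrt ((frequencies d L).card : ℝ) : ℝ) : ℂ) *
        ∑ n ∈ frequencies d L, a n *
          character n (fun j => q j + ((Λ * x j / L : ℝ) : AddCircle (2 * Real.pi)))) := by
    refine (hasSum_sum fun n _ => ?_).mul_left _
    rw [character_add_coe n q fun j => Λ * x j / L]
    have e : ∑ j, Λ * x j / L * n j = ∑ j, x j * (Λ * n j / L) :=
      Finset.sum_congr rfl fun j _ => by ring
    rw [e]
    exact ((hasSum_mono_mul_symbol x fun j => Λ * n j / L).mul_left _).mul_left _
  have h2 := Complex.hasSum_re h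
  rw [← h2.tsum_eq]
  refine tsum_congr fun w => ?_
  rw [trigCoef, mul_comm _ (mono w x), ← Complex.re_ofReal_mul]
  congr 1
  simp only [Finset.mul_sum]
  refine Finset.sum_congr rfl fun n _ => ?_
  ring

theorem measurableSet_cube (d : ℕ) (Λ : ℝ) : MeasurableSet (cube d Λ) := measurableSet_Icc

theorem volume_real_cube {Λ : ℝ} (hΛ : 0 < Λ) : volume.real (cube d Λ) = (2 * Λ) ^ d := by
  rw [cube, Measure.real, Real.volume_Icc_pi_toReal fun _ => by linarith]
  simp [two_mul]

theorem abs_le_of_mem_cube {Λ : ℝ} {ξ : Fin d → ℝ} (hξ : ξ ∈ cube d Λ) (j : Fin d) :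
    |ξ j| ≤ Λ := abs_le.2 ⟨hξ.1 j, hξ.2 j⟩

theorem neg_mem_cube {Λ : ℝ} {ξ : Fin d → ℝ} : -ξ ∈ cube d Λ ↔ ξ ∈ cube d Λ := by
  simp only [cube, Set.mem_Icc, Pi.le_def, Pi.neg_apply]
  constructor <;> rintro ⟨h1, h2⟩ <;>
    exact ⟨fun j => by linarith [h2 j], fun j => by linarith [h1 j]⟩

/-- The exponential `e^{iπ n·ξ/Λ}`. -/
def wave (Λ : ℝ) (n : Fin d → ℤ) (ξ : Fin d → ℝ) : ℂ :=
  Complex.exp (Complex.I * ((Real.pi * (∑ j, (n j : ℝ) * ξ j) / Λ : ℝ) : ℂ))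

theorem continuous_wave (Λ : ℝ) (n : Fin d → ℤ) : Continuous (wave Λ n) := by
  unfold wave
  fun_prop

theorem norm_wave (Λ : ℝ) (n : Fin d → ℤ) (ξ : Fin d → ℝ) : ‖wave Λ n ξ‖ = 1 := by
  rw [wave, mul_comm, Complex.norm_exp_ofReal_mul_I]

theorem setIntegral_mul_phi (Λ : ℝ) (g : (Fin d → ℝ) → ℂ) (n : Fin d → ℤ) :
    ∫ ξ in cube d Λ, g ξ * phi Λ n ξ = ∫ ξ in cube d Λ, g ξ * wave Λ n ξ := by
  refine setIntegral_congr_fun (measurableSet_cube d Λ) fun ξ hξ => ?_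
  simp only [phi, Set.indicator_of_mem hξ, wave]

theorem integrableOn_mul_wave (Λ : ℝ) {g : (Fin d → ℝ) → ℂ} (hg : Continuous g)
    (n : Fin d → ℤ) : IntegrableOn (fun ξ => g ξ * wave Λ n ξ) (cube d Λ) :=
  (hg.mul (continuous_wave Λ n)).continuousOn.integrableOn_compact isCompact_Icc

/-- The reflection `ξ ↦ -ξ` preserves the cube and conjugates the integrand, so the integral is
real. -/
theorem ofReal_cubeCoef (Λ : ℝ) {g : (Fin d → ℝ) → ℂ}
    (hg : ∀ ξ, g (-ξ) = (starRingEnd ℂ) (g ξ)) (n : Fin d → ℤ) :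
    (cubeCoef Λ g n : ℂ) =
      (((2 * Λ) ^ d)⁻¹ : ℝ) * ∫ ξ in cube d Λ, g ξ * wave Λ n ξ := by
  rw [cubeCoef, setIntegral_mul_phi]
  apply Complex.conj_eq_iff_re.mp
  simp only [map_mul, Complex.conj_ofReal]
  congr 1
  have hs := measurableSet_cube d Λ
  rw [← integral_conj, ← integral_indicator hs, ← integral_indicator hs, ← integral_neg_eq_self]
  refine integral_congr_ae (Eventually.of_forall fun ξ => ?_)
  by_cases h : ξ ∈ cube d Λ
  · have h' := neg_mem_cube.2 h
    simp [h, h', wave, hg, ← Complex.exp_conj, Finset.sum_neg_distrib, neg_div]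
  · have h' : -ξ ∉ cube d Λ := fun h'' => h (neg_mem_cube.1 h'')
    beta_reduce
    rw [Set.indicator_of_notMem h', Set.indicator_of_notMem h]

theorem cubeCoef_sum {ι : Type*} (Λ : ℝ) (s : Finset ι) (t : ι → ℝ)
    {g : ι → (Fin d → ℝ) → ℂ} (hg : ∀ i, Continuous (g i)) (n : Fin d → ℤ) :
    cubeCoef Λ (fun ξ => ∑ i ∈ s, (t i : ℂ) * g i ξ) n = ∑ i ∈ s, t i * cubeCoef Λ (g i) n := by
  rw [cubeCoef, setIntegral_mul_phi]
  simp only [Finset.sum_mul]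
  rw [integral_finsetSum]
  · simp only [mul_assoc, integral_const_mul, Finset.mul_sum, Complex.re_sum]
    refine Finset.sum_congr rfl fun i _ => ?_
    rw [cubeCoef, setIntegral_mul_phi, ← Complex.re_ofReal_mul]
    congr 1
    ring
  · intro i _
    exact integrableOn_mul_wave Λ (continuous_const.mul (hg i)) n

theorem trigCoef_sum {ι : Type*} (Λ : ℝ) (L : ℕ) (a : (Fin d → ℤ) → ℂ) (q : Torus d)
    (s : Finset ι) (t : ι → ℝ) (g : ι → (Fin d → ℝ) → ℂ) :
    trigCoef Λ L a q (fun ξ => ∑ i ∈ s, (t i : ℂ) * g i ξ) =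
      ∑ i ∈ s, t i * trigCoef Λ L a q (g i) := by
  simp only [trigCoef, ← Complex.re_ofReal_mul, ← Complex.re_sum]
  congr 1
  simp only [Finset.mul_sum]
  rw [Finset.sum_comm]
  refine Finset.sum_congr rfl fun i _ => Finset.sum_congr rfl fun n _ => ?_
  ring

/-- The expansion of `e^{i x·ξ}` is dominated uniformly over the cube, which has finite volume, and
may be integrated term by term. -/
theorem hasSum_phiHat {Λ : ℝ} (hΛ : 0 < Λ) (n : Fin d → ℤ) (x : Space d) :
    HasSum (fun w => cubeCoef Λ (symbol w) n * mono w x) (phiHat Λ n x) := by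
  have hx : ∀ j, |x j| ≤ ∑ i, |x i| := fun j =>
    Finset.single_le_sum (f := fun i => |x i|) (fun _ _ => abs_nonneg _) (Finset.mem_univ j)
  have hbs := summable_word_factorial (d := d) (A := Λ) (B := ∑ i, |x i|) hΛ.le
    (Finset.sum_nonneg fun _ _ => abs_nonneg _)
  have hfin : IsFiniteMeasure (volume.restrict (cube d Λ)) :=
    ⟨by rw [Measure.restrict_apply_univ]; exact isCompact_Icc.measure_lt_top⟩
  have h : HasSum (fun w => ∫ ξ in cube d Λ, (mono w x : ℂ) * symbol w ξ * phi Λ n ξ)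
      (∫ ξ in cube d Λ,
        Complex.exp (Complex.I * ((∑ j, x j * ξ j : ℝ) : ℂ)) * phi Λ n ξ) := by
    refine hasSum_integral_of_dominated_convergence
      (fun w _ => Λ ^ w.1 / w.1.factorial * (∑ i, |x i|) ^ w.1) (fun w => ?_) (fun w => ?_)
      (Eventually.of_forall fun _ => hbs) (integrable_const _) (Eventually.of_forall fun ξ => ?_)
    · refine AEStronglyMeasurable.congr (f := fun ξ => (mono w x : ℂ) * symbol w ξ * wave Λ n ξ)
        (Continuous.aestronglyMeasurable
          ((continuous_const.mul (continuous_symbol w)).mul (continuous_wave Λ n))) ?_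
      filter_upwards [ae_restrict_mem (measurableSet_cube d Λ)] with ξ hξ
      simp only [phi, Set.indicator_of_mem hξ, wave]
    · filter_upwards [ae_restrict_mem (measurableSet_cube d Λ)] with ξ hξ
      have e : ‖phi Λ n ξ‖ = 1 := by
        simp only [phi, Set.indicator_of_mem hξ]
        exact norm_wave Λ n ξ
      rw [norm_mul, norm_mul, e, mul_one, mul_comm, Complex.norm_real, Real.norm_eq_abs]
      have h1 := norm_symbol_le w (abs_le_of_mem_cube hξ)
      have h2 := abs_mono_le w hx
      gcongr
    · exact (hasSum_mono_mul_symbol x ξ).mul_right _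
  have h2 := Complex.hasSum_re (h.mul_left ((((2 * Λ) ^ d)⁻¹ : ℝ) : ℂ))
  rw [phiHat, phiHatComplex]
  refine h2.congr_fun fun w => ?_
  rw [cubeCoef, mul_comm _ (mono w x), ← Complex.re_ofReal_mul]
  congr 1
  simp only [mul_assoc, integral_const_mul]
  ring

/-- The coefficient of the partial sum of `W` over a cube that corresponds to the symbol `g`. -/
def partialCoef (Λ : ℝ) (b : (Fin d → ℤ) → ℝ) (g : (Fin d → ℝ) → ℂ) (N : ℕ) : ℝ :=
  ∑ n ∈ Finset.Icc (fun _ => -(N : ℤ)) (fun _ => (N : ℤ)), cubeCoef Λ g n * b n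

theorem partialSum_eq_field {Λ : ℝ} (hΛ : 0 < Λ) (b : (Fin d → ℤ) → ℝ) (N : ℕ) :
    partialSum Λ b N = field fun w => partialCoef Λ b (symbol w) N := by
  ext x
  rw [partialSum, field]
  have h := hasSum_sum (s := Finset.Icc (fun _ => -(N : ℤ)) (fun _ => (N : ℤ)))
    fun n _ => (hasSum_phiHat hΛ n x).mul_left (b n)
  rw [← h.tsum_eq]
  refine tsum_congr fun w => ?_
  rw [partialCoef, Finset.sum_mul]
  exact Finset.sum_congr rfl fun n _ => by ring

end Expansion

/-! ### Riemann sums over the rescaled frequencies. -/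

section RiemannSums

variable {d : ℕ}

open scoped Pointwise in
theorem setIntegral_comp_smul_cube {E : Type*} [NormedAddCommGroup E] [NormedSpace ℝ E]
    {Λ c : ℝ} (hc : 0 < c) (h : (Fin d → ℝ) → E) :
    ∫ x in cube d Λ, h (c • x) = (c ^ d)⁻¹ • ∫ ξ in cube d (c * Λ), h ξ := by
  rw [Measure.setIntegral_comp_smul_of_pos volume h _ hc]
  congr 2
  · simp
  · congr 2
    ext x
    rw [Set.mem_smul_set_iff_inv_smul_mem₀ hc.ne']
    simp only [cube, Set.mem_Icc, Pi.le_def, Pi.smul_apply, smul_eq_mul, ← forall_and]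
    refine forall_congr' fun i => ?_
    rw [le_inv_mul_iff₀ hc, inv_mul_le_iff₀ hc, mul_neg]

open scoped Pointwise in
theorem tendsto_sum_Icc_div_pow {F : (Fin d → ℝ) → ℝ} (hF : Continuous F) :
    Tendsto (fun L : ℕ => (∑ n ∈ Finset.Icc (fun _ : Fin d => -(L : ℤ)) (fun _ => (L : ℤ)),
      F fun j => n j / L) / (L : ℝ) ^ d) atTop (𝓝 (∫ x in cube d 1, F x)) := by
  -- The boundary of the cube is null by convexity; what remains is to identify the points of the
  -- lattice `L⁻¹ ℤ^d` in the cube with the indices of the sum.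
  have h := tendsto_tsum_div_pow_atTop_integral (cube d 1) F hF
    isCompact_Icc.isBounded (measurableSet_cube d 1)
    ((convex_Icc _ _).addHaar_frontier volume)
  rw [Fintype.card_fin] at h
  refine h.congr' ?_
  filter_upwards [eventually_ge_atTop 1] with L hL
  have hL0 : NeZero L := ⟨by omega⟩
  have hLpos : (0 : ℝ) < L := by exact_mod_cast hL
  congr 1
  classical
  have hinj : Function.Injective fun (n : Fin d → ℤ) (j : Fin d) => (n j : ℝ) / L := by
    intro m n hmn
    ext j
    have := congrFun hmn j
    simp only at this
    rw [div_left_inj' hLpos.ne'] at this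
    exact_mod_cast this
  have hset : (cube d 1 ∩ (L : ℝ)⁻¹ •
      (Submodule.span ℤ (Set.range (Pi.basisFun ℝ (Fin d))) : Set (Fin d → ℝ))) =
      ↑((Finset.Icc (fun _ : Fin d => -(L : ℤ)) (fun _ => (L : ℤ))).image
        fun (n : Fin d → ℤ) (j : Fin d) => (n j : ℝ) / L) := by
    ext x
    rw [Set.mem_inter_iff, ← Submodule.coe_pointwise_smul, SetLike.mem_coe,
      BoxIntegral.unitPartition.mem_smul_span_iff]
    simp only [Finset.coe_image, Finset.coe_Icc, Set.mem_image]
    constructor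
    · rintro ⟨hx, hn⟩
      choose n hn using hn
      refine ⟨n, ?_, ?_⟩
      · refine ⟨fun j => ?_, fun j => ?_⟩
        · have := hx.1 j
          have h1 : (-(L : ℝ)) ≤ n j := by
            have e : (n j : ℝ) = L * x j := hn j
            rw [e]
            nlinarith
          exact_mod_cast h1
        · have := hx.2 j
          have h1 : (n j : ℝ) ≤ L := by
            have e : (n j : ℝ) = L * x j := hn j
            rw [e]
            nlinarith
          exact_mod_cast h1
      · ext j
        have e : (n j : ℝ) = L * x j := hn j
        rw [e]
        field_simp
    · rintro ⟨n, hn, rfl⟩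
      refine ⟨⟨fun j => ?_, fun j => ?_⟩, fun j => ⟨n j, ?_⟩⟩
      · have h1 : (-(L : ℝ)) ≤ n j := by exact_mod_cast hn.1 j
        change (-1 : ℝ) ≤ n j / L
        rw [le_div_iff₀ hLpos]
        linarith
      · have h1 : (n j : ℝ) ≤ L := by exact_mod_cast hn.2 j
        change (n j : ℝ) / L ≤ 1
        rw [div_le_iff₀ hLpos]
        linarith
      · simp only [eq_intCast]
        field_simp
  rw [hset, Finset.tsum_subtype', Finset.sum_image fun _ _ _ _ h => hinj h]

theorem tendsto_sum_frequencies_div_pow (hd : 1 ≤ d) {F : (Fin d → ℝ) → ℝ} (hF : Continuous F) :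
    Tendsto (fun L : ℕ => (∑ n ∈ frequencies d L, F fun j => n j / L) / (L : ℝ) ^ d) atTop
      (𝓝 (∫ x in cube d 1, F x)) := by
  -- The excluded frequency `0` contributes `F 0 / L ^ d`, which vanishes in the limit because `d ≥
  -- 1`.
  have h0 : Tendsto (fun L : ℕ => F 0 / (L : ℝ) ^ d) atTop (𝓝 0) :=
    tendsto_const_nhds.div_atTop
      ((tendsto_pow_atTop (by omega)).comp tendsto_natCast_atTop_atTop)
  have h := (tendsto_sum_Icc_div_pow hF).sub h0
  rw [sub_zero] at h
  refine h.congr fun L => ?_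
  have hmem : (0 : Fin d → ℤ) ∈ Finset.Icc (fun _ : Fin d => -(L : ℤ)) (fun _ => (L : ℤ)) := by
    simp [Pi.le_def]
  rw [frequencies, ← Finset.add_sum_erase _ _ hmem, ← sub_div]
  congr 1
  have e : (fun j : Fin d => ((0 : Fin d → ℤ) j : ℝ) / L) = 0 := by
    ext j
    simp
  rw [e]
  ring

/-- The means of a function over the rescaled frequencies converge to its mean over the cube. -/
theorem tendsto_mean_frequencies (hd : 1 ≤ d) {Λ : ℝ} (hΛ : 0 < Λ) {F : (Fin d → ℝ) → ℝ}
    (hF : Continuous F) :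
    Tendsto (fun L : ℕ => ((frequencies d L).card : ℝ)⁻¹ *
      ∑ n ∈ frequencies d L, F fun j => Λ * n j / L) atTop
      (𝓝 (((2 * Λ) ^ d)⁻¹ * ∫ ξ in cube d Λ, F ξ)) := by
  have h1 := tendsto_sum_frequencies_div_pow hd (F := fun x => F (Λ • x)) (by fun_prop)
  -- The number of frequencies is the Riemann sum of the constant `1`; dividing the two sums cancels
  -- `L ^ d`.
  have h2 := tendsto_sum_frequencies_div_pow hd (F := fun _ => 1) continuous_const
  rw [setIntegral_comp_smul_cube hΛ, mul_one, smul_eq_mul] at h1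
  have hvol : ∫ _ in cube d 1, (1 : ℝ) = 2 ^ d := by
    rw [setIntegral_const, volume_real_cube one_pos]
    simp
  rw [hvol] at h2
  have h := h1.div h2 (by positivity)
  have e : (Λ ^ d)⁻¹ * (∫ ξ in cube d Λ, F ξ) / 2 ^ d =
      ((2 * Λ) ^ d)⁻¹ * ∫ ξ in cube d Λ, F ξ := by
    rw [mul_pow]
    field_simp
  rw [e] at h
  refine h.congr' ?_
  filter_upwards [eventually_ge_atTop 1] with L hL
  have hLpos : (0 : ℝ) < L := by exact_mod_cast hL
  rw [Pi.div_apply, div_div_div_cancel_right₀ (by positivity)]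
  simp only [Finset.sum_const, nsmul_eq_mul, mul_one]
  rw [div_eq_inv_mul]
  congr 1
  refine Finset.sum_congr rfl fun n _ => ?_
  congr 1
  ext j
  simp only [Pi.smul_apply, smul_eq_mul]
  ring

end RiemannSums

/-! ### Parseval's identity on the cube. -/

section Parseval

variable {d : ℕ}

theorem setIntegral_half_box {E : Type*} [NormedAddCommGroup E] [NormedSpace ℝ E]
    {Λ : ℝ} (hΛ : 0 < Λ) (h : (Fin d → ℝ) → E) :
    ∫ x in {x : Fin d → ℝ | ∀ i, x i ∈ Set.Ioc (-(1 / 2) : ℝ) (-(1 / 2) + 1)}, h ((2 * Λ) • x) =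
      ((2 * Λ) ^ d)⁻¹ • ∫ ξ in cube d Λ, h ξ := by
  have e : {x : Fin d → ℝ | ∀ i, x i ∈ Set.Ioc (-(1 / 2) : ℝ) (-(1 / 2) + 1)} =
      Set.pi Set.univ fun _ : Fin d => Set.Ioc (-(1 / 2) : ℝ) (1 / 2) := by
    ext x
    norm_num [Set.mem_pi]
  rw [e, volume_pi, setIntegral_congr_set Measure.univ_pi_Ioc_ae_eq_Icc, ← volume_pi]
  have h2 := setIntegral_comp_smul_cube (d := d) (Λ := 1 / 2) (c := 2 * Λ) (by positivity) h
  rw [show 2 * Λ * (1 / 2) = Λ by ring] at h2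
  exact h2

/-- **Parseval's identity** on the cube. -/
theorem hasSum_sq_cubeCoef {Λ : ℝ} (hΛ : 0 < Λ) {g : (Fin d → ℝ) → ℂ} (hg : Continuous g)
    (hsymm : ∀ ξ, g (-ξ) = (starRingEnd ℂ) (g ξ)) :
    HasSum (fun n => cubeCoef Λ g n ^ 2) (((2 * Λ) ^ d)⁻¹ * ∫ ξ in cube d Λ, ‖g ξ‖ ^ 2) := by
  -- Volume on the circle is normalized Haar measure, for which the characters are orthonormal.
  let _ : MeasureSpace UnitAddCircle := ⟨AddCircle.haarAddCircle⟩
  have _ : IsProbabilityMeasure (volume : Measure UnitAddCircle) :=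
    inferInstanceAs (IsProbabilityMeasure AddCircle.haarAddCircle)
  -- The section of the torus over the half-open box `(-1/2, 1/2]^d`. Through it `g` on the cube
  -- becomes `f` on the torus; `f` may jump at the seam, so only its square integrability is used.
  let s : UnitAddTorus (Fin d) → (Fin d → ℝ) := fun y i =>
    (AddCircle.measurableEquivIoc 1 (-(1 / 2)) (y i) : ℝ)
  have hs : Measurable s := measurable_pi_lambda _ fun i =>
    measurable_subtype_coe.comp
      ((AddCircle.measurableEquivIoc 1 (-(1 / 2))).measurable.comp (measurable_pi_apply i))
  have hs1 : ∀ x : Fin d → ℝ, (∀ i, x i ∈ Set.Ioc (-(1 / 2) : ℝ) (-(1 / 2) + 1)) →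
      s (fun i => (x i : UnitAddCircle)) = x := by
    intro x hx
    ext i
    exact AddCircle.equivIoc_coe_of_mem (p := (1 : ℝ)) (hx i)
  have hscube : ∀ y, (2 * Λ) • s y ∈ cube d Λ := by
    intro y
    have h1 : ∀ i, s y i ∈ Set.Ioc (-(1 / 2) : ℝ) (-(1 / 2) + 1) := fun i =>
      (AddCircle.measurableEquivIoc 1 (-(1 / 2)) (y i)).2
    constructor
    · intro i
      have := (h1 i).1
      simp only [Pi.smul_apply, smul_eq_mul]
      nlinarith
    · intro i
      have := (h1 i).2
      simp only [Pi.smul_apply, smul_eq_mul]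
      nlinarith
  let f : UnitAddTorus (Fin d) → ℂ := fun y => g ((2 * Λ) • s y)
  have hfm : Measurable f := hg.measurable.comp (hs.const_smul (2 * Λ))
  obtain ⟨A, hA⟩ := (isCompact_Icc : IsCompact (cube d Λ)).exists_bound_of_continuousOn
    hg.continuousOn
  have hfL : MemLp f 2 volume :=
    MemLp.of_bound hfm.aestronglyMeasurable A (Eventually.of_forall fun y => hA _ (hscube y))
  have hP := UnitAddTorus.hasSum_sq_mFourierCoeff (hfL.toLp f)
  have hint : ∫ t, ‖(hfL.toLp f) t‖ ^ 2 = ((2 * Λ) ^ d)⁻¹ * ∫ ξ in cube d Λ, ‖g ξ‖ ^ 2 := by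
    have e1 : ∫ t, ‖(hfL.toLp f) t‖ ^ 2 = ∫ t, ‖f t‖ ^ 2 := by
      refine integral_congr_ae ?_
      filter_upwards [hfL.coeFn_toLp] with t ht
      rw [ht]
    rw [e1]
    have e2 := UnitAddTorus.integral_preimage (fun t => ‖f t‖ ^ 2) fun _ : Fin d => -(1 / 2)
    refine e2.trans ?_
    rw [← smul_eq_mul, ← setIntegral_half_box hΛ fun ξ => ‖g ξ‖ ^ 2]
    refine setIntegral_congr_fun (MeasurableSet.univ_pi' fun i => measurableSet_Ioc)
      fun x hx => ?_
    simp only [f, hs1 x hx]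
  -- The sign: `wave` carries `e^{+iπ n·ξ/Λ}`, whereas Fourier coefficients carry the conjugate
  -- character. The final sum is reindexed by `n ↦ -n`.
  have hcoef : ∀ n : Fin d → ℤ, UnitAddTorus.mFourierCoeff (hfL.toLp f) (-n) =
      (cubeCoef Λ g n : ℂ) := by
    intro n
    have e1 : UnitAddTorus.mFourierCoeff (hfL.toLp f) (-n) = UnitAddTorus.mFourierCoeff f (-n) := by
      refine integral_congr_ae ?_
      filter_upwards [hfL.coeFn_toLp] with t ht
      rw [ht]
    rw [e1, UnitAddTorus.mFourierCoeff_eq_integral f (-n) fun _ => -(1 / 2), neg_neg,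
      ofReal_cubeCoef Λ hsymm, ← Complex.real_smul,
      ← setIntegral_half_box hΛ fun ξ => g ξ * wave Λ n ξ]
    refine setIntegral_congr_fun (MeasurableSet.univ_pi' fun i => measurableSet_Ioc)
      fun x hx => ?_
    simp only [f, hs1 x hx, smul_eq_mul]
    rw [mul_comm]
    congr 1
    change ∏ i, (fourier (n i) (x i : UnitAddCircle) : ℂ) = _
    simp only [fourier_coe_apply, wave]
    rw [← Complex.exp_sum]
    congr 1
    simp only [Pi.smul_apply, smul_eq_mul]
    rw [mul_div_assoc, Finset.sum_div, Finset.mul_sum, Complex.ofReal_sum, Finset.mul_sum]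
    refine Finset.sum_congr rfl fun i _ => ?_
    push_cast
    have : (Λ : ℂ) ≠ 0 := by exact_mod_cast hΛ.ne'
    field_simp
  rw [hint] at hP
  have hN := (Equiv.neg (Fin d → ℤ)).hasSum_iff.2 hP
  refine hN.congr_fun fun n => ?_
  simp only [Function.comp_apply, Equiv.neg_apply, hcoef, Complex.norm_real, Real.norm_eq_abs,
    sq_abs]

end Parseval

/-! ### The law of the coefficients of the trigonometric potential. -/

section TrigonometricLaw

variable {d : ℕ}

open Classical in
-- Lexicographic positivity selects exactly one of any two opposite nonzero frequencies.
theorem sum_frequencies_eq_two_mul (L : ℕ) {f : (Fin d → ℤ) → ℝ} (hf : ∀ n, n ≠ 0 → f (-n) = f n) :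
    ∑ n ∈ frequencies d L, f n =
      2 * ∑ n ∈ (frequencies d L).filter fun n => 0 < toLex n, f n := by
  rw [← Finset.sum_filter_add_sum_filter_not (frequencies d L) fun n => 0 < toLex n, two_mul]
  congr 1
  refine Finset.sum_bij' (fun n _ => -n) (fun n _ => -n) ?_ ?_ (fun n _ => neg_neg n)
    (fun n _ => neg_neg n) ?_
  · intro n hn
    rw [Finset.mem_filter, mem_frequencies] at hn ⊢
    refine ⟨by simpa using hn.1, ?_⟩
    rw [toLex_neg, neg_pos]
    exact lt_of_le_of_ne (not_lt.1 hn.2) fun h => hn.1.1 (toLex.injective h)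
  · intro n hn
    rw [Finset.mem_filter, mem_frequencies] at hn ⊢
    refine ⟨by simpa using hn.1, ?_⟩
    rw [toLex_neg, neg_pos]
    exact fun h => lt_asymm h hn.2
  · intro n hn
    rw [Finset.mem_filter, mem_frequencies] at hn
    exact (hf n hn.1.1).symm

variable {Ω : Type*} [MeasurableSpace Ω] {P : Measure Ω} [IsProbabilityMeasure P]

/-- Opposite frequencies contribute conjugate terms, leaving a sum of `2 s Re (u n * a n)` over half
the frequencies, which is a combination of independent normal variables. Since `‖u n‖` does not see
the character, the variance does not depend on `q`. -/
theorem hasLaw_trigCoef {a : (Fin d → ℤ) → Ω → ℂ} (ha : IsTrigCoefficients P a) (Λ : ℝ) (L : ℕ)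
    (q : Torus d) {g : (Fin d → ℝ) → ℂ} (hg : ∀ ξ, g (-ξ) = (starRingEnd ℂ) (g ξ)) :
    HasLaw (fun ω => trigCoef Λ L (fun n => a n ω) q g)
      (gaussianReal 0 (Real.toNNReal (((frequencies d L).card : ℝ)⁻¹ *
        ∑ n ∈ frequencies d L, ‖g fun j => Λ * n j / L‖ ^ 2))) P := by
  classical
  let S : Set (Fin d → ℤ) := {n | 0 < toLex n}
  have hS : ∀ n ∈ S, -n ∉ S := by
    intro n (hn : 0 < toLex n) (hn' : 0 < toLex (-n))
    rw [toLex_neg, neg_pos] at hn'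
    exact lt_asymm hn hn'
  have hS0 : ∀ n ∈ S, n ≠ 0 := by
    rintro n (hn : 0 < toLex n) rfl
    exact lt_irrefl _ hn
  let s : ℝ := 1 / Real.sqrt ((frequencies d L).card : ℝ)
  have hs2 : s ^ 2 = ((frequencies d L).card : ℝ)⁻¹ := by
    rw [div_pow, Real.sq_sqrt (Nat.cast_nonneg _), one_pow, one_div]
  let u : (Fin d → ℤ) → ℂ := fun n => character n q * g fun j => Λ * n j / L
  have hu : ∀ n, u (-n) = (starRingEnd ℂ) (u n) := by
    intro n
    have h1 : character (-n) q = (starRingEnd ℂ) (character n q) := by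
      simp only [character, map_prod, Pi.neg_apply]
      exact Finset.prod_congr rfl fun j _ => fourier_neg
    have h2 : (fun j => Λ * ((-n) j : ℤ) / L : Fin d → ℝ) = -fun j => Λ * n j / L := by
      ext j
      simp only [Pi.neg_apply, Int.cast_neg]
      ring
    simp only [u, h1, h2, hg, map_mul]
  have hun : ∀ n, ‖u n‖ = ‖g fun j => Λ * n j / L‖ := fun n => by
    rw [norm_mul, norm_character, one_mul]
  let H := (frequencies d L).filter fun n => 0 < toLex n
  let T : Finset S := H.subtype (· ∈ S)
  have hT : ∀ f : (Fin d → ℤ) → ℝ, ∑ n ∈ T, f n = ∑ n ∈ H, f n := by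
    intro f
    rw [Finset.sum_subtype_eq_sum_filter, Finset.filter_true_of_mem]
    intro n hn
    exact (Finset.mem_filter.1 hn).2
  -- From `Re (u a) = Re u Re a - Im u Im a`. The squares add up to `4 s² ‖u n‖²`; the variance
  -- `1/2` of the parts and the sum over half the frequencies then give `s²` times the full sum.
  let c : S ⊕ S → ℝ := Sum.elim (fun n => 2 * s * (u n).re) fun n => -(2 * s * (u n).im)
  have hlaw : ∀ i : S ⊕ S, HasLaw ((Sum.elim (fun (n : S) ω => (a n ω).re)
      (fun (n : S) ω => (a n ω).im) : S ⊕ S → Ω → ℝ) i) (gaussianReal 0 (1 / 2)) P := by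
    rintro (n | n)
    · exact ha.law_re n (hS0 n n.2)
    · exact ha.law_im n (hS0 n n.2)
  have h := hasLaw_sum_gaussianReal hlaw (ha.indep S hS) (T.disjSum T) c
  have hvar : (∑ i ∈ T.disjSum T, c i ^ 2) * ((1 / 2 : ℝ≥0) : ℝ) =
      ((frequencies d L).card : ℝ)⁻¹ *
        ∑ n ∈ frequencies d L, ‖g fun j => Λ * n j / L‖ ^ 2 := by
    rw [Finset.sum_disjSum]
    simp only [c, Sum.elim_inl, Sum.elim_inr]
    rw [hT fun n => (2 * s * (u n).re) ^ 2, hT fun n => (-(2 * s * (u n).im)) ^ 2,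
      ← Finset.sum_add_distrib]
    simp only [← hun]
    rw [sum_frequencies_eq_two_mul L fun n _ => by rw [hu, RCLike.norm_conj], ← hs2]
    simp only [← Complex.normSq_eq_norm_sq, Complex.normSq_apply, Finset.mul_sum, Finset.sum_mul]
    refine Finset.sum_congr rfl fun n _ => ?_
    push_cast
    ring
  rw [hvar] at h
  refine h.congr ?_
  have hconj : ∀ᵐ ω ∂P, ∀ n, n ≠ 0 → a (-n) ω = (starRingEnd ℂ) (a n ω) :=
    ae_all_iff.2 fun n => by
      by_cases hn : n = 0
      · exact Eventually.of_forall fun ω h => absurd hn h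
      · exact (ha.conj n hn).mono fun ω h _ => h
  filter_upwards [hconj] with ω hω
  rw [Finset.sum_disjSum, trigCoef, Complex.re_ofReal_mul, Complex.re_sum,
    sum_frequencies_eq_two_mul L fun n hn => by
      change (a (-n) ω * u (-n)).re = (a n ω * u n).re
      rw [hω n hn, hu, ← map_mul, Complex.conj_re]]
  simp only [c, Sum.elim_inl, Sum.elim_inr]
  rw [hT fun n => 2 * s * (u n).re * (a n ω).re, hT fun n => -(2 * s * (u n).im) * (a n ω).im,
    ← Finset.sum_add_distrib, ← mul_assoc, Finset.mul_sum]
  refine Finset.sum_congr rfl fun n _ => ?_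
  change s * 2 * (a n ω * u n).re = _
  rw [Complex.mul_re]
  ring

/-- The variance is a mean of `‖symbol w‖²` over points of the cube, hence bounded independently of
`L`. -/
theorem lintegral_enorm_trigCoef_symbol_le {a : (Fin d → ℤ) → Ω → ℂ}
    (ha : IsTrigCoefficients P a) {Λ : ℝ} (hΛ : 0 ≤ Λ) (L : ℕ) (q : Torus d) (w : Word d) :
    ∫⁻ ω, ‖trigCoef Λ L (fun n => a n ω) q (symbol w)‖ₑ ∂P ≤
      ENNReal.ofReal (Λ ^ w.1 / w.1.factorial) := by
  have h := hasLaw_trigCoef ha Λ L q (symbol_neg w)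
  set v : ℝ := ((frequencies d L).card : ℝ)⁻¹ *
    ∑ n ∈ frequencies d L, ‖symbol w fun j => Λ * n j / L‖ ^ 2 with hv
  have hv0 : 0 ≤ v := mul_nonneg (by positivity) (Finset.sum_nonneg fun _ _ => by positivity)
  rw [← Real.sq_sqrt hv0] at h
  refine (lintegral_enorm_le_of_hasLaw (Real.sqrt_nonneg _) h).trans
    (ENNReal.ofReal_le_ofReal (Real.sqrt_le_iff.2 ⟨by positivity, ?_⟩))
  have h1 : ∑ n ∈ frequencies d L, ‖symbol w fun j => Λ * n j / L‖ ^ 2 ≤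
      (frequencies d L).card * (Λ ^ w.1 / w.1.factorial) ^ 2 := by
    rw [← nsmul_eq_mul]
    refine Finset.sum_le_card_nsmul _ _ _ fun n hn => ?_
    have := norm_symbol_le w (abs_freq_div_le hΛ hn)
    gcongr
  exact inv_mul_le_of_le_mul₀ (Nat.cast_nonneg _) (sq_nonneg _) h1

end TrigonometricLaw

/-! ### Construction of `W` and the law of its coefficients. -/

section LimitField

variable {d : ℕ}

/-- The coefficient of the word `w` in the power series of `W`. -/
def limitCoef (Λ : ℝ) (b : (Fin d → ℤ) → ℝ) (w : Word d) : ℝ :=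
  limUnder atTop fun N => partialCoef Λ b (symbol w) N

theorem monotone_Icc_cube (d : ℕ) :
    Monotone fun N : ℕ => Finset.Icc (fun _ : Fin d => -(N : ℤ)) (fun _ => (N : ℤ)) := by
  intro M N h
  refine Finset.Icc_subset_Icc (fun j => ?_) fun j => ?_
  · have : (M : ℤ) ≤ N := by exact_mod_cast h
    simpa using this
  · change (M : ℤ) ≤ N
    exact_mod_cast h

theorem tendsto_Icc_cube (d : ℕ) :
    Tendsto (fun N : ℕ => Finset.Icc (fun _ : Fin d => -(N : ℤ)) (fun _ => (N : ℤ))) atTop atTop := by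
  refine tendsto_atTop_finset_of_monotone (monotone_Icc_cube d) fun n => ?_
  refine ⟨∑ j, (n j).natAbs, ?_⟩
  have h : ∀ j, |n j| ≤ ((∑ i, (n i).natAbs : ℕ) : ℤ) := fun j => by
    rw [Int.abs_eq_natAbs]
    exact_mod_cast Finset.single_le_sum (f := fun i => (n i).natAbs) (fun _ _ => Nat.zero_le _)
      (Finset.mem_univ j)
  rw [Finset.mem_Icc]
  exact ⟨fun j => (abs_le.1 (h j)).1, fun j => (abs_le.1 (h j)).2⟩

theorem sum_sq_cubeCoef_le {Λ : ℝ} (hΛ : 0 < Λ) {g : (Fin d → ℝ) → ℂ} (hg : Continuous g)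
    (hsymm : ∀ ξ, g (-ξ) = (starRingEnd ℂ) (g ξ)) {A : ℝ} (hA : ∀ ξ ∈ cube d Λ, ‖g ξ‖ ≤ A)
    (s : Finset (Fin d → ℤ)) : ∑ n ∈ s, cubeCoef Λ g n ^ 2 ≤ A ^ 2 := by
  refine (sum_le_hasSum s (fun _ _ => sq_nonneg _) (hasSum_sq_cubeCoef hΛ hg hsymm)).trans ?_
  rw [inv_mul_le_iff₀ (by positivity), ← volume_real_cube hΛ]
  have h : ∫ ξ in cube d Λ, ‖g ξ‖ ^ 2 ≤ ∫ _ in cube d Λ, A ^ 2 := by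
    refine setIntegral_mono_on (Continuous.integrableOn_Icc (by fun_prop))
      (integrableOn_const isCompact_Icc.measure_lt_top.ne) (measurableSet_cube d Λ)
      fun ξ hξ => ?_
    have := hA ξ hξ
    gcongr
  rwa [setIntegral_const, smul_eq_mul] at h

variable {Ω : Type*} [MeasurableSpace Ω] {P : Measure Ω} [IsProbabilityMeasure P]

/-- With `d ^ k` words of length `k`, the choice of `D` gives `d * B / D ≤ 1 / 2`, so a geometric
series dominates. -/
theorem summable_of_eventually_abs_le {z : Word d → ℝ} {B : ℕ} {D : ℝ}
    (hD : D = 2 * (d + 1) * (B + 1)) (h : ∀ᶠ w in cofinite, |z w| ≤ (D ^ w.1)⁻¹) :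
    Summable fun w => |z w| * (B : ℝ) ^ w.1 := by
  have hD0 : 0 < D := by rw [hD]; positivity
  have hs : Summable fun w : Word d => (D ^ w.1)⁻¹ * (B : ℝ) ^ w.1 := by
    refine summable_word (f := fun k => (D ^ k)⁻¹ * (B : ℝ) ^ k) (fun k => by positivity) ?_
    refine summable_geometric_two.of_nonneg_of_le (fun k => by positivity) fun k => ?_
    rw [← inv_pow, ← mul_pow, ← mul_pow]
    gcongr
    rw [hD, ← div_eq_inv_mul, ← mul_div_assoc, div_le_iff₀ (by positivity)]
    have h1 : (0 : ℝ) ≤ d := Nat.cast_nonneg d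
    have h2 : (0 : ℝ) ≤ B := Nat.cast_nonneg B
    nlinarith
  refine hs.of_norm_bounded_eventually (h.mono fun w hw => ?_)
  rw [Real.norm_of_nonneg (by positivity)]
  gcongr

/-- Convergence of each coefficient alone does not give convergence of the fields. The additional
input is a sequence, summable against all geometric weights, that dominates the coefficients of all
partial sums at once. -/
theorem ae_limitCoef_of_measurable {Λ : ℝ} (hΛ : 0 < Λ) {b : (Fin d → ℤ) → Ω → ℝ}
    (hm : ∀ n, Measurable (b n)) (hb : ∀ n, HasLaw (b n) (gaussianReal 0 1) P)
    (hind : iIndepFun b P) :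
    ∀ᵐ ω ∂P, Decays (limitCoef Λ fun n => b n ω) ∧
      (∀ w, Tendsto (fun N => partialCoef Λ (fun n => b n ω) (symbol w) N) atTop
        (𝓝 (limitCoef Λ (fun n => b n ω) w))) ∧
      ∀ x, Tendsto (fun N => partialSum Λ (fun n => b n ω) N x) atTop
        (𝓝 (field (limitCoef Λ fun n => b n ω) x)) := by
  have hvar : ∀ (w : Word d) (N : ℕ),
      ∑ n ∈ Finset.Icc (fun _ : Fin d => -(N : ℤ)) (fun _ => (N : ℤ)),
        cubeCoef Λ (symbol w) n ^ 2 ≤ (Λ ^ w.1 / w.1.factorial) ^ 2 := fun w N =>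
    sum_sq_cubeCoef_le hΛ (continuous_symbol w) (symbol_neg w)
      (fun ξ hξ => norm_symbol_le w (abs_le_of_mem_cube hξ)) _
  have hconv : ∀ᵐ ω ∂P, ∀ w : Word d, ∃ c,
      Tendsto (fun N => partialCoef Λ (fun n => b n ω) (symbol w) N) atTop (𝓝 c) :=
    ae_all_iff.2 fun w =>
      ae_exists_tendsto_sum_gaussian hm hb hind (monotone_Icc_cube d) (by positivity) (hvar w)
  have hfin : ∀ᵐ ω ∂P, ∀ B : ℕ, {w : Word d | ∃ N,
      ((2 * (d + 1) * (B + 1) : ℝ) ^ w.1)⁻¹ ≤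
        |partialCoef Λ (fun n => b n ω) (symbol w) N|}.Finite := by
    refine ae_all_iff.2 fun B => ?_
    -- Borel–Cantelli over words: with `D = 2 (d + 1) (B + 1)`, the event of a word of length `k`
    -- has probability at most `Λ^k / k! * D^k`, which is summable over words.
    refine ae_finite_setOfPred_mem (s := fun w : Word d => {ω | ∃ N,
      ((2 * (d + 1) * (B + 1) : ℝ) ^ w.1)⁻¹ ≤
        |partialCoef Λ (fun n => b n ω) (symbol w) N|}) ?_
    refine ne_top_of_le_ne_top (summable_word_factorial (d := d) (A := Λ)
      (B := 2 * (d + 1) * (B + 1)) hΛ.le (by positivity)).tsum_ofReal_ne_top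
      (ENNReal.tsum_le_tsum fun w => ?_)
    have h := measure_exists_le_abs_sum_gaussian_le hm hb hind (monotone_Icc_cube d)
      (σ := Λ ^ w.1 / w.1.factorial) (by positivity) (hvar w)
      (t := ((2 * (d + 1) * (B + 1) : ℝ) ^ w.1)⁻¹) (by positivity)
    rwa [div_inv_eq_mul] at h
  filter_upwards [hconv, hfin] with ω h1 h2
  set Z : Word d → ℕ → ℝ := fun w N => partialCoef Λ (fun n => b n ω) (symbol w) N with hZ
  have hlim : ∀ w, Tendsto (Z w) atTop (𝓝 (limitCoef Λ (fun n => b n ω) w)) := fun w => by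
    obtain ⟨c, hc⟩ := h1 w
    rw [limitCoef, hc.limUnder_eq]
    exact hc
  have hbdd : ∀ w, BddAbove (Set.range fun N => |Z w N|) := fun w =>
    (hlim w).abs.bddAbove_range
  -- The dominating sequence. Outside finitely many words it is at most `D ^ (-k)`, for each integer
  -- `B`, which yields `Decays u`.
  let u : Word d → ℝ := fun w => ⨆ N, |Z w N|
  have hZu : ∀ w N, |Z w N| ≤ u w := fun w N => le_ciSup (hbdd w) N
  have hu0 : ∀ w, 0 ≤ u w := fun w => (abs_nonneg _).trans (hZu w 0)
  have hu : Decays u := by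
    intro B hB
    have hs := summable_of_eventually_abs_le (z := u) (B := ⌈B⌉₊) rfl <| by
      filter_upwards [(h2 ⌈B⌉₊).compl_mem_cofinite] with w hw
      rw [abs_of_nonneg (hu0 w)]
      refine ciSup_le fun N => ?_
      by_contra hlt
      exact hw ⟨N, (not_le.1 hlt).le⟩
    refine hs.of_nonneg_of_le (fun w => by positivity) fun w => ?_
    gcongr
    exact Nat.le_ceil B
  have hle : ∀ w, |limitCoef Λ (fun n => b n ω) w| ≤ |u w| := fun w => by
    rw [abs_of_nonneg (hu0 w)]
    exact le_of_tendsto (hlim w).abs (Eventually.of_forall fun N => hZu w N)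
  refine ⟨hu.of_abs_le hle, hlim, fun x => ?_⟩
  simp only [partialSum_eq_field hΛ, field]
  refine tendsto_tsum_of_dominated_convergence
    ((hu.summable x).norm) (fun w => (hlim w).mul_const _) (Eventually.of_forall fun N w => ?_)
  rw [norm_mul, norm_mul]
  gcongr
  rw [Real.norm_eq_abs, Real.norm_of_nonneg (hu0 w)]
  exact hZu w N

/-- A law only provides almost everywhere measurability, while the filtration needs measurable
variables; the `b n` are replaced by measurable modifications. -/
theorem ae_limitCoef {Λ : ℝ} (hΛ : 0 < Λ) {b : (Fin d → ℤ) → Ω → ℝ}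
    (hb : ∀ n, HasLaw (b n) (gaussianReal 0 1) P) (hind : iIndepFun b P) :
    ∀ᵐ ω ∂P, Decays (limitCoef Λ fun n => b n ω) ∧
      (∀ w, Tendsto (fun N => partialCoef Λ (fun n => b n ω) (symbol w) N) atTop
        (𝓝 (limitCoef Λ (fun n => b n ω) w))) ∧
      ∀ x, Tendsto (fun N => partialSum Λ (fun n => b n ω) N x) atTop
        (𝓝 (field (limitCoef Λ fun n => b n ω) x)) := by
  have hae : ∀ n, b n =ᵐ[P] (hb n).aemeasurable.mk (b n) := fun n => (hb n).aemeasurable.ae_eq_mk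
  have h := ae_limitCoef_of_measurable hΛ (fun n => (hb n).aemeasurable.measurable_mk)
    (fun n => (hb n).congr (hae n).symm) (hind.congr hae)
  filter_upwards [h, ae_all_iff.2 hae] with ω h1 h2
  rw [show (fun n => b n ω) = fun n => (hb n).aemeasurable.mk (b n) ω from funext h2]
  exact h1

theorem aemeasurable_limitCoef {Λ : ℝ} (hΛ : 0 < Λ) {b : (Fin d → ℤ) → Ω → ℝ}
    (hb : ∀ n, HasLaw (b n) (gaussianReal 0 1) P) (hind : iIndepFun b P) (w : Word d) :
    AEMeasurable (fun ω => limitCoef Λ (fun n => b n ω) w) P := by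
  have hbm : ∀ n, AEMeasurable (b n) P := fun n => (hb n).aemeasurable
  refine aemeasurable_of_tendsto_metrizable_ae'
    (f := fun N ω => partialCoef Λ (fun n => b n ω) (symbol w) N) (fun N => ?_)
    ((ae_limitCoef hΛ hb hind).mono fun ω h => h.2.1 w)
  unfold partialCoef
  fun_prop

/-- The symbol of a linear combination of coefficients. -/
def combSymbol (F : Finset (Word d)) (t : Word d → ℝ) (ξ : Fin d → ℝ) : ℂ :=
  ∑ w ∈ F, (t w : ℂ) * symbol w ξ

theorem continuous_combSymbol (F : Finset (Word d)) (t : Word d → ℝ) :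
    Continuous (combSymbol F t) :=
  continuous_finsetSum _ fun w _ => continuous_const.mul (continuous_symbol w)

theorem combSymbol_neg (F : Finset (Word d)) (t : Word d → ℝ) (ξ : Fin d → ℝ) :
    combSymbol F t (-ξ) = (starRingEnd ℂ) (combSymbol F t ξ) := by
  simp only [combSymbol, symbol_neg, map_sum, map_mul, Complex.conj_ofReal]

/-- For finite `N` the combination is normal with variance a partial Parseval sum for `combSymbol F
t`. Dominated convergence handles the left side as `N → ∞`, Parseval's identity the right. -/
theorem integral_cexp_limitCoef {Λ : ℝ} (hΛ : 0 < Λ) {b : (Fin d → ℤ) → Ω → ℝ}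
    (hb : ∀ n, HasLaw (b n) (gaussianReal 0 1) P) (hind : iIndepFun b P) (F : Finset (Word d))
    (t : Word d → ℝ) :
    ∫ ω, Complex.exp (((∑ w ∈ F, t w * limitCoef Λ (fun n => b n ω) w : ℝ) : ℂ) * Complex.I) ∂P =
      Complex.exp (-((((2 * Λ) ^ d)⁻¹ * ∫ ξ in cube d Λ, ‖combSymbol F t ξ‖ ^ 2 : ℝ) : ℂ) / 2) := by
  have hbm : ∀ n, AEMeasurable (b n) P := fun n => (hb n).aemeasurable
  have hfin : ∀ N, ∫ ω, Complex.exp (((∑ w ∈ F, t w *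
      partialCoef Λ (fun n => b n ω) (symbol w) N : ℝ) : ℂ) * Complex.I) ∂P =
      Complex.exp (-((∑ n ∈ Finset.Icc (fun _ : Fin d => -(N : ℤ)) (fun _ => (N : ℤ)),
        cubeCoef Λ (combSymbol F t) n ^ 2 : ℝ) : ℂ) / 2) := by
    intro N
    have hlaw := hasLaw_sum_gaussianReal hb hind
      (Finset.Icc (fun _ : Fin d => -(N : ℤ)) (fun _ => (N : ℤ))) (cubeCoef Λ (combSymbol F t))
    rw [NNReal.coe_one, mul_one] at hlaw
    rw [← integral_cexp_of_hasLaw (Finset.sum_nonneg fun _ _ => sq_nonneg _) hlaw]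
    congr 1 with ω
    congr 3
    simp only [partialCoef, Finset.mul_sum]
    rw [Finset.sum_comm]
    refine Finset.sum_congr rfl fun n _ => ?_
    have h := cubeCoef_sum Λ F t continuous_symbol n
    change cubeCoef Λ (combSymbol F t) n = _ at h
    rw [h, Finset.sum_mul]
    exact Finset.sum_congr rfl fun w _ => by ring
  have hL : Tendsto (fun N : ℕ => ∫ ω, Complex.exp (((∑ w ∈ F, t w *
      partialCoef Λ (fun n => b n ω) (symbol w) N : ℝ) : ℂ) * Complex.I) ∂P) atTop
      (𝓝 (∫ ω, Complex.exp (((∑ w ∈ F, t w *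
        limitCoef Λ (fun n => b n ω) w : ℝ) : ℂ) * Complex.I) ∂P)) := by
    refine tendsto_integral_of_dominated_convergence (fun _ => 1) (fun N => ?_)
      (integrable_const _) (fun N => Eventually.of_forall fun ω => ?_) ?_
    · refine AEMeasurable.aestronglyMeasurable ?_
      unfold partialCoef
      fun_prop
    · rw [Complex.norm_exp_ofReal_mul_I]
    · filter_upwards [ae_limitCoef hΛ hb hind] with ω hω
      have h1 : Tendsto (fun N => ∑ w ∈ F, t w * partialCoef Λ (fun n => b n ω) (symbol w) N)
          atTop (𝓝 (∑ w ∈ F, t w * limitCoef Λ (fun n => b n ω) w)) :=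
        tendsto_finsetSum _ fun w _ => (hω.2.1 w).const_mul _
      have hc : Continuous fun x : ℝ => Complex.exp ((x : ℂ) * Complex.I) := by fun_prop
      exact (hc.tendsto _).comp h1
  simp only [hfin] at hL
  refine tendsto_nhds_unique hL ?_
  have h2 := (hasSum_sq_cubeCoef hΛ (continuous_combSymbol F t) (combSymbol_neg F t)).comp
    (tendsto_Icc_cube d)
  have hc : Continuous fun x : ℝ => Complex.exp (-(x : ℂ) / 2) := by fun_prop
  exact (hc.tendsto _).comp h2

end LimitField

/-! ### Truncation to short words. -/

section Truncation

variable {d : ℕ}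

/-- The words of length less than `K`. -/
def shortWords (d K : ℕ) : Finset (Word d) := (Finset.range K).sigma fun _ => Finset.univ

theorem mem_shortWords {K : ℕ} {w : Word d} : w ∈ shortWords d K ↔ w.1 < K := by
  simp [shortWords]

/-- The coefficients of the words of length less than `K`, the others being replaced by `0`. -/
def trunc (K : ℕ) (z : Word d → ℝ) (w : Word d) : ℝ := if w.1 < K then z w else 0

/-- The coefficients `t` of the words of length less than `K`, extended by `0`. -/
def extendZero (K : ℕ) (t : EuclideanSpace ℝ (shortWords d K)) (w : Word d) : ℝ :=
  if h : w ∈ shortWords d K then t ⟨w, h⟩ else 0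

theorem abs_trunc_sub (K : ℕ) (z : Word d → ℝ) (w : Word d) :
    |trunc K z w - z w| = if w.1 < K then 0 else |z w| := by
  unfold trunc
  split_ifs <;> simp

theorem Decays.trunc {z : Word d → ℝ} (h : Decays z) (K : ℕ) :
    Decays (RandomPotential.trunc K z) :=
  h.of_abs_le fun w => by
    unfold RandomPotential.trunc
    split_ifs <;> simp

theorem extendZero_toLp (K : ℕ) (z : Word d → ℝ) :
    extendZero K (WithLp.toLp 2 fun i : shortWords d K => z i) = trunc K z := by
  ext w
  simp only [extendZero, trunc, mem_shortWords]
  split_ifs <;> rfl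

theorem extendZero_coe (K : ℕ) (t : EuclideanSpace ℝ (shortWords d K)) (i : shortWords d K) :
    extendZero K t i = t i := by
  simp [extendZero]

theorem extendZero_of_notMem {K : ℕ} (t : EuclideanSpace ℝ (shortWords d K)) {w : Word d}
    (h : w ∉ shortWords d K) : extendZero K t w = 0 := by
  simp [extendZero, h]

theorem decays_extendZero (K : ℕ) (t : EuclideanSpace ℝ (shortWords d K)) :
    Decays (extendZero K t) := fun B _ =>
  summable_of_ne_finset_zero (s := shortWords d K) fun w hw => by
    rw [extendZero_of_notMem t hw, abs_zero, zero_mul]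

theorem tendsto_tail {z : Word d → ℝ} (h : Decays z) {B : ℝ} (hB : 0 ≤ B) :
    Tendsto (fun K => ∑' w, |trunc K z w - z w| * B ^ w.1) atTop (𝓝 0) := by
  rw [show (0 : ℝ) = ∑' _ : Word d, (0 : ℝ) from tsum_zero.symm]
  refine tendsto_tsum_of_dominated_convergence (h B hB) (fun w => ?_)
    (Eventually.of_forall fun K w => ?_)
  · refine tendsto_const_nhds.congr' ?_
    filter_upwards [eventually_gt_atTop w.1] with K hK
    rw [abs_trunc_sub, if_pos hK, zero_mul]
  · rw [Real.norm_of_nonneg (by positivity), abs_trunc_sub]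
    gcongr
    split_ifs
    · positivity
    · exact le_rfl

/-- Lets the continuous mapping theorem carry convergence of finite blocks of coefficients over to
`CrBall`. -/
theorem continuous_ofFun_field_extendZero (r K : ℕ) {R : ℝ} (hR : 0 < R) :
    Continuous fun t : EuclideanSpace ℝ (shortWords d K) =>
      CrBall.ofFun r R (field (extendZero K t)) := by
  obtain ⟨C, B, hC, hB, h⟩ := exists_dist_field_le d r hR
  rw [continuous_iff_continuousAt]
  intro t₀
  rw [ContinuousAt, tendsto_iff_dist_tendsto_zero]
  have hlim : Tendsto (fun t : EuclideanSpace ℝ (shortWords d K) =>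
      C * ∑ i : shortWords d K, |t i - t₀ i| * B ^ i.1.1) (𝓝 t₀) (𝓝 0) := by
    have hc : Continuous fun t : EuclideanSpace ℝ (shortWords d K) =>
      C * ∑ i : shortWords d K, |t i - t₀ i| * B ^ i.1.1 := by fun_prop
    have := hc.tendsto t₀
    simpa using this
  refine squeeze_zero (fun _ => dist_nonneg) (fun t => ?_) hlim
  refine (h _ _ (decays_extendZero K t) (decays_extendZero K t₀)).trans (le_of_eq ?_)
  rw [tsum_eq_sum (s := shortWords d K) fun w hw => by
    rw [extendZero_of_notMem t hw, extendZero_of_notMem t₀ hw, sub_zero, abs_zero, zero_mul],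
    ← Finset.sum_coe_sort]
  simp only [extendZero_coe]

end Truncation

/-! ### Convergence in distribution of the coefficients, then of the fields. -/

section Convergence

variable {d : ℕ} {Ω Ω' : Type*} [MeasurableSpace Ω] [MeasurableSpace Ω']
  {P : Measure Ω} [IsProbabilityMeasure P] {P' : Measure Ω'} [IsProbabilityMeasure P']

theorem inner_toLp_shortWords (K : ℕ) (z : Word d → ℝ) (t : EuclideanSpace ℝ (shortWords d K)) :
    inner ℝ (WithLp.toLp 2 fun i : shortWords d K => z i) t =
      ∑ w ∈ shortWords d K, extendZero K t w * z w := by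
  rw [← Finset.sum_coe_sort]
  simp only [extendZero_coe, PiLp.inner_apply, RCLike.inner_apply, conj_trivial]

/-- Pairing with `t` produces the coefficient of `combSymbol`. Both characteristic functions are
then `exp (-v / 2)`, and only the variances `v` have to be compared. -/
theorem tendstoInDistribution_coef (hd : 1 ≤ d) {Λ : ℝ} (hΛ : 0 < Λ)
    {a : (Fin d → ℤ) → Ω → ℂ} (ha : IsTrigCoefficients P a)
    {b : (Fin d → ℤ) → Ω' → ℝ} (hb : ∀ n, HasLaw (b n) (gaussianReal 0 1) P')
    (hind : iIndepFun b P') (q : Torus d) (K : ℕ) :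
    TendstoInDistribution
      (fun (L : ℕ) ω => (WithLp.toLp 2 fun i : shortWords d K =>
        trigCoef Λ L (fun n => a n ω) q (symbol i.1) : EuclideanSpace ℝ (shortWords d K)))
      atTop
      (fun ω => (WithLp.toLp 2 fun i : shortWords d K =>
        limitCoef Λ (fun n => b n ω) i.1 : EuclideanSpace ℝ (shortWords d K)))
      (fun _ => P) P' := by
  refine tendstoInDistribution_of_tendsto_integral_cexp (fun L => ?_) ?_ fun t => ?_
  · exact (WithLp.measurable_toLp 2 _).comp_aemeasurable (aemeasurable_pi_lambda _ fun i =>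
      (hasLaw_trigCoef ha Λ L q (symbol_neg i.1)).aemeasurable)
  · exact (WithLp.measurable_toLp 2 _).comp_aemeasurable (aemeasurable_pi_lambda _ fun i =>
      aemeasurable_limitCoef hΛ hb hind i.1)
  · have hX : ∀ (L : ℕ) (ω : Ω), inner ℝ (WithLp.toLp 2 fun i : shortWords d K =>
        trigCoef Λ L (fun n => a n ω) q (symbol i.1)) t =
        trigCoef Λ L (fun n => a n ω) q (combSymbol (shortWords d K) (extendZero K t)) := by
      intro L ω
      rw [inner_toLp_shortWords K fun w => trigCoef Λ L (fun n => a n ω) q (symbol w)]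
      exact (trigCoef_sum Λ L _ q _ _ symbol).symm
    have hZ : ∀ ω : Ω', inner ℝ (WithLp.toLp 2 fun i : shortWords d K =>
        limitCoef Λ (fun n => b n ω) i.1) t =
        ∑ w ∈ shortWords d K, extendZero K t w * limitCoef Λ (fun n => b n ω) w := fun ω =>
      inner_toLp_shortWords K _ t
    simp only [hX, hZ]
    rw [integral_cexp_limitCoef hΛ hb hind]
    have hE := fun L => integral_cexp_of_hasLaw
      (mul_nonneg (by positivity) (Finset.sum_nonneg fun _ _ => sq_nonneg _))
      (hasLaw_trigCoef ha Λ L q (combSymbol_neg (shortWords d K) (extendZero K t)))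
    simp only [hE]
    have hc : Continuous fun x : ℝ => Complex.exp (-(x : ℂ) / 2) := by fun_prop
    exact (hc.tendsto _).comp (tendsto_mean_frequencies hd hΛ
      ((continuous_combSymbol (shortWords d K) (extendZero K t)).norm.pow 2))

theorem tendsto_ofFun_trunc (r : ℕ) {R : ℝ} (hR : 0 < R) {z : Word d → ℝ} (hz : Decays z) :
    Tendsto (fun K => CrBall.ofFun r R (field (trunc K z))) atTop
      (𝓝 (CrBall.ofFun r R (field z))) := by
  obtain ⟨C, B, hC, hB, h⟩ := exists_dist_field_le d r hR
  rw [tendsto_iff_dist_tendsto_zero]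
  have hlim := (tendsto_tail hz hB).const_mul C
  rw [mul_zero] at hlim
  exact squeeze_zero (fun _ => dist_nonneg) (fun K => h _ _ (hz.trunc K) hz) hlim

theorem tendstoInDistribution_field (hd : 1 ≤ d) {Λ : ℝ} (hΛ : 0 < Λ)
    {a : (Fin d → ℤ) → Ω → ℂ} (ha : IsTrigCoefficients P a)
    {b : (Fin d → ℤ) → Ω' → ℝ} (hb : ∀ n, HasLaw (b n) (gaussianReal 0 1) P')
    (hind : iIndepFun b P') (q : Torus d) (r : ℕ) {R : ℝ} (hR : 0 < R) :
    TendstoInDistribution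
      (fun (L : ℕ) ω => CrBall.ofFun r R
        (field fun w => trigCoef Λ L (fun n => a n ω) q (symbol w)))
      atTop (fun ω => CrBall.ofFun r R (field (limitCoef Λ fun n => b n ω)))
      (fun _ => P) P' := by
  obtain ⟨C, B, hC, hB, hdist⟩ := exists_dist_field_le d r hR
  -- A deterministic bound for the mean absolute coefficients, uniform in `L`; its weighted tail
  -- beyond length `K` is the error `ε K`.
  let σ : Word d → ℝ := fun w => Λ ^ w.1 / w.1.factorial
  have hσ0 : ∀ w, 0 ≤ σ w := fun w => by positivity
  have hσ : Decays σ := decays_of_abs_le (A := 1) hΛ.le fun w => by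
    rw [one_mul, abs_of_nonneg (hσ0 w)]
  refine tendstoInDistribution_of_approx
    (Y := fun L K ω => CrBall.ofFun r R
      (field (trunc K fun w => trigCoef Λ L (fun n => a n ω) q (symbol w))))
    (T := fun K ω => CrBall.ofFun r R (field (trunc K (limitCoef Λ fun n => b n ω))))
    (ε := fun K => ENNReal.ofReal (C * ∑' w, |trunc K σ w - σ w| * B ^ w.1))
    (fun K => ?_) (fun L => Eventually.of_forall fun ω => ?_) ?_ ?_ fun L K => ?_
  · have h := (tendstoInDistribution_coef hd hΛ ha hb hind q K).continuous_comp
      (continuous_ofFun_field_extendZero r K hR)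
    refine h.congr (fun L => Eventually.of_forall fun ω => ?_)
      (Eventually.of_forall fun ω => ?_)
    · exact congrArg (fun z => CrBall.ofFun r R (field z))
        (extendZero_toLp K fun w => trigCoef Λ L (fun n => a n ω) q (symbol w))
    · exact congrArg (fun z => CrBall.ofFun r R (field z))
        (extendZero_toLp K (limitCoef Λ fun n => b n ω))
  · exact tendsto_ofFun_trunc r hR (decays_trigCoef hΛ.le L _ q)
  · filter_upwards [ae_limitCoef hΛ hb hind] with ω hω
    exact tendsto_ofFun_trunc r hR hω.1
  · have hlim := (tendsto_tail hσ hB).const_mul C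
    rw [mul_zero] at hlim
    simpa using ENNReal.tendsto_ofReal hlim
  · let z : Ω → Word d → ℝ := fun ω w => trigCoef Λ L (fun n => a n ω) q (symbol w)
    have hz : ∀ ω, Decays (z ω) := fun ω => decays_trigCoef hΛ.le L _ q
    have hzm : ∀ w, AEMeasurable (fun ω => z ω w) P := fun w =>
      (hasLaw_trigCoef ha Λ L q (symbol_neg w)).aemeasurable
    have hsum : ∀ y : Word d → ℝ, Decays y →
        ENNReal.ofReal (C * ∑' w, |trunc K y w - y w| * B ^ w.1) =
          ENNReal.ofReal C * ∑' w, ENNReal.ofReal (|trunc K y w - y w| * B ^ w.1) := by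
      intro y hy
      rw [ENNReal.ofReal_mul hC, ENNReal.ofReal_tsum_of_nonneg (fun w => by positivity)
        ((hy.trunc K).sub hy B hB)]
    rw [hsum σ hσ]
    calc ∫⁻ ω, edist (CrBall.ofFun r R (field (trunc K (z ω))))
          (CrBall.ofFun r R (field (z ω))) ∂P
        ≤ ∫⁻ ω, ENNReal.ofReal C *
            ∑' w, ENNReal.ofReal (|trunc K (z ω) w - z ω w| * B ^ w.1) ∂P := by
          refine lintegral_mono fun ω => ?_
          rw [← hsum _ (hz ω), edist_dist]
          exact ENNReal.ofReal_le_ofReal (hdist _ _ ((hz ω).trunc K) (hz ω))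
      -- Tonelli's theorem, which reduces the mean error to the first moments of single
      -- coefficients.
      _ = ENNReal.ofReal C *
            ∑' w, ∫⁻ ω, ENNReal.ofReal (|trunc K (z ω) w - z ω w| * B ^ w.1) ∂P := by
          rw [lintegral_const_mul' _ _ ENNReal.ofReal_ne_top, lintegral_tsum fun w => ?_]
          simp only [abs_trunc_sub]
          have := hzm w
          split_ifs <;> fun_prop
      _ ≤ _ := by
          gcongr with w
          simp only [abs_trunc_sub, abs_of_nonneg (hσ0 w)]
          split_ifs
          · simp
          · simp only [ENNReal.ofReal_mul (abs_nonneg _), ENNReal.ofReal_mul (hσ0 w),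
              ← Real.enorm_eq_ofReal_abs]
            rw [lintegral_mul_const' _ _ ENNReal.ofReal_ne_top]
            gcongr
            exact lintegral_enorm_trigCoef_symbol_le ha hΛ.le L q w

end Convergence

end RandomPotential

end

/-! ### The main theorem. -/

theorem lemma4p2 {Ω Ω' : Type*} [MeasurableSpace Ω] [MeasurableSpace Ω']
    (P : Measure Ω) [IsProbabilityMeasure P] (P' : Measure Ω') [IsProbabilityMeasure P']
    (d : ℕ) (hd : 1 ≤ d) (r : ℕ) (Λ : ℝ) (hΛ : 0 < Λ) (R : ℝ) (hR : 0 < R)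
    (a : (Fin d → ℤ) → Ω → ℂ) (ha : RandomPotential.IsTrigCoefficients P a)
    (b : (Fin d → ℤ) → Ω' → ℝ) (hb : ∀ n, HasLaw (b n) (gaussianReal 0 1) P')
    (hb_indep : iIndepFun b P')
    (q : RandomPotential.Torus d) :
    -- the rescaled trigonometric potentials are of class `C^r`
    (∀ (L : ℕ) (ω : Ω),
      ContDiff ℝ r (RandomPotential.rescaledPotential Λ L (fun n => a n ω) q)) ∧
    -- almost surely, the series defining `W` converges and `W` is of class `C^r`
    (∀ᵐ ω ∂P',
      (∀ x, Tendsto (fun N => RandomPotential.partialSum Λ (fun n => b n ω) N x) atTop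
        (𝓝 (RandomPotential.limitPotential Λ (fun n => b n ω) x))) ∧
      ContDiff ℝ r (RandomPotential.limitPotential Λ (fun n => b n ω))) ∧
    -- both fields are random variables in `C^r(B_R)`, and their laws there converge weakly
    TendstoInDistribution
      (fun (L : ℕ) (ω : Ω) => RandomPotential.CrBall.ofFun r R
        (RandomPotential.rescaledPotential Λ L (fun n => a n ω) q))
      atTop
      (fun ω : Ω' => RandomPotential.CrBall.ofFun r R
        (RandomPotential.limitPotential Λ (fun n => b n ω)))
      (fun _ => P) P' := by
  have hW := RandomPotential.ae_limitCoef hΛ hb hb_indep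
  -- `limitPotential` is a `limUnder`, meaningful only where the partial sums converge; almost
  -- surely it is the power series with coefficients `limitCoef`.
  have hfield : ∀ᵐ ω ∂P', RandomPotential.limitPotential Λ (fun n => b n ω) =
      RandomPotential.field (RandomPotential.limitCoef Λ fun n => b n ω) := by
    filter_upwards [hW] with ω hω
    ext x
    exact (hω.2.2 x).limUnder_eq
  refine ⟨fun L ω => ?_, ?_, ?_⟩
  · rw [RandomPotential.rescaledPotential_eq_field]
    exact RandomPotential.contDiff_field r (RandomPotential.decays_trigCoef hΛ.le L _ q)
  · filter_upwards [hW, hfield] with ω hω hωf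
    rw [hωf]
    exact ⟨hω.2.2, RandomPotential.contDiff_field r hω.1⟩
  · refine (RandomPotential.tendstoInDistribution_field hd hΛ ha hb hb_indep q r hR).congr
      (fun L => Eventually.of_forall fun ω => ?_) ?_
    · beta_reduce
      rw [RandomPotential.rescaledPotential_eq_field]
    · filter_upwards [hfield] with ω hωf
      rw [hωf]
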